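/- Let $\mathbb K\in\{\mathbb R,\mathbb C\}$, $N\ge 1$ an integer, $p\in(2,6)$, $q\in(2,4)$. Let $S_N$ be the star graph made of $N$ half-lines $\mathcal H_1,\dots,\mathcal H_N\cong[0,\infty)$ glued at their common origin $0$, and let $H^1(S_N)$ be the space of functions $u=(u_1,\dots,u_N):S_N\to\mathbb K$ that are continuous on $S_N$ (in particular at $0$) with $u_i\in H^1(\mathcal H_i)$ for every $i$, with $\|u\|_{H^1(S_N)}^2=\sum_i\|u_i\|_{H^1(\mathcal H_i)}^2$ and $\|u\|_{L^2(S_N)}^2=\sum_i\|u_i\|_{L^2(\mathcal H_i)}^2$. For $\mu>0$ put $$F_{p,q}(u)=\frac12\int_{S_N}|u'|^2\,dx-\frac1p\int_{S_N}|u|^p\,dx-\frac1q|u(0)|^q,\qquad \mathcal F_{p,q}(\mu)=\inf\{F_{p,q}(u): u\in H^1(S_N),\ \|u\|_{L^2(S_N)}^2=\mu\},$$ $$E(v)=\frac12\int_{\mathbb R}|v'|^2\,dx-\frac1p\int_{\mathbb R}|v|^p\,dx,\qquad \mathcal E(\mu)=\inf\{E(v): v\in H^1(\mathbb R),\ \|v\|_{L^2(\mathbb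 R)}^2=\mu\}.$$ A ground state at mass $\mu$ is a function $u\in H^1(S_N)$ with $\|u\|_{L^2(S_N)}^2=\mu$ and $F_{p,q}(u)=\mathcal F_{p,q}(\mu)$. Then for every $\mu>0$ $$\mathcal F_{p,q}(\mu)\le\mathcal E(\mu).$$ Furthermore, if $\mathcal F_{p,q}(\mu)<\mathcal E(\mu)$, then ground states at mass $\mu$ exist, and every minimizing sequence, i.e. every sequence $(u_n)\subset H^1(S_N)$ with $\|u_n\|_{L^2(S_N)}^2=\mu$ for all $n$ and $F_{p,q}(u_n)\to\mathcal F_{p,q}(\mu)$, has a subsequence that converges strongly in $H^1(S_N)$ to a ground state at mass $\mu$. -/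

import Mathlib

open MeasureTheory Filter Topology Set
open scoped ContDiff

namespace StarNLS

noncomputable section

/-- `g` is a weak derivative of `u` on the open set `Ω ⊆ ℝ`: the integration by parts formula holds
against all test functions `φ ∈ C_c^∞(Ω)`. -/
def IsWeakDeriv {𝕜 : Type*} [RCLike 𝕜] (Ω : Set ℝ) (u g : ℝ → 𝕜) : Prop :=
  ∀ φ : ℝ → ℝ, ContDiff ℝ ∞ φ → HasCompactSupport φ → tsupport φ ⊆ Ω →
    ∫ x in Ω, deriv φ x • u x = -∫ x in Ω, φ x • g x

/-- `u ∈ H¹(Ω)`: `u` is in `L²(Ω)` and has a weak derivative in `L²(Ω)`.  Only the values of `u`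
on `Ω` matter. -/
def MemH1 {𝕜 : Type*} [RCLike 𝕜] (Ω : Set ℝ) (u : ℝ → 𝕜) : Prop :=
  MemLp u 2 (volume.restrict Ω) ∧
    ∃ g : ℝ → 𝕜, MemLp g 2 (volume.restrict Ω) ∧ IsWeakDeriv Ω u g

open Classical in
/-- The weak derivative `u'` of a function `u ∈ H¹(Ω)` (determined almost everywhere on `Ω`);
it is set to `0` if `u ∉ H¹(Ω)`. -/
def weakDeriv {𝕜 : Type*} [RCLike 𝕜] (Ω : Set ℝ) (u : ℝ → 𝕜) : ℝ → 𝕜 :=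
  if h : MemH1 Ω u then h.2.choose else 0

/-! ### The real line -/

/-- `H¹_m(ℝ)`: the functions in `H¹(ℝ)` with `‖v‖_{L²(ℝ)}² = m`. -/
def H1MassLine (𝕜 : Type*) [RCLike 𝕜] (m : ℝ) : Set (ℝ → 𝕜) :=
  {v | MemH1 univ v ∧ ∫ x, ‖v x‖ ^ 2 = m}

/-- The standard NLS energy on the line,
`E(v) = 1/2 ∫_ℝ |v'|² - 1/p ∫_ℝ |v|^p`. -/
def lineEnergy {𝕜 : Type*} [RCLike 𝕜] (p : ℝ) (v : ℝ → 𝕜) : ℝ :=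
  1 / 2 * (∫ x, ‖weakDeriv univ v x‖ ^ 2) - 1 / p * ∫ x, ‖v x‖ ^ p

/-- `ℰ(m) = inf {E(v) : v ∈ H¹_m(ℝ)}`, the infimum being taken in the extended reals. -/
def lineLevel (𝕜 : Type*) [RCLike 𝕜] (p m : ℝ) : EReal :=
  ⨅ v ∈ H1MassLine 𝕜 m, (lineEnergy p v : EReal)

/-! ### The star graph with `N` half-lines

A function on the star graph `S_N` is the family `u` of its restrictions `u i`, `i : Fin N`, to the
half-lines `[0, ∞)`, the points `0` of all half-lines being the vertex.  The values of `u i` on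
`(-∞, 0)` play no role. -/

/-- `u ∈ H¹(S_N)`: every `u i` is in `H¹(0, ∞)` and `u` is continuous on the graph, that is,
every `u i` is continuous on `[0, ∞)` and the values of the `u i` at the vertex agree. -/
structure MemH1Star {𝕜 : Type*} [RCLike 𝕜] {N : ℕ} (u : Fin N → ℝ → 𝕜) : Prop where
  memH1 : ∀ i, MemH1 (Ioi 0) (u i)
  continuousOn : ∀ i, ContinuousOn (u i) (Ici 0)
  vertex : ∀ i j, u i 0 = u j 0

/-- `‖u‖_{L²(S_N)}²`. -/
def starMass {𝕜 : Type*} [RCLike 𝕜] {N : ℕ} (u : Fin N → ℝ → 𝕜) : ℝ :=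
  ∑ i, ∫ x in Ioi 0, ‖u i x‖ ^ 2

/-- `‖u'‖_{L²(S_N)}²`. -/
def starKinetic {𝕜 : Type*} [RCLike 𝕜] {N : ℕ} (u : Fin N → ℝ → 𝕜) : ℝ :=
  ∑ i, ∫ x in Ioi 0, ‖weakDeriv (Ioi 0) (u i) x‖ ^ 2

/-- `‖u‖_{H¹(S_N)}²`. -/
def starH1NormSq {𝕜 : Type*} [RCLike 𝕜] {N : ℕ} (u : Fin N → ℝ → 𝕜) : ℝ :=
  starMass u + starKinetic u

/-- `H¹_m(S_N)`: the functions in `H¹(S_N)` with `‖u‖_{L²(S_N)}² = m`. -/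
def H1MassStar (𝕜 : Type*) [RCLike 𝕜] (N : ℕ) (m : ℝ) : Set (Fin N → ℝ → 𝕜) :=
  {u | MemH1Star u ∧ starMass u = m}

/-- The doubly nonlinear energy on the star graph,
`F_{p,q}(u) = 1/2 ∫_{S_N} |u'|² - 1/p ∫_{S_N} |u|^p - 1/q |u(0)|^q`.
The value of `u` at the vertex is read off on the half-line with index `0`. -/
def starEnergy {𝕜 : Type*} [RCLike 𝕜] {N : ℕ} [NeZero N] (p q : ℝ) (u : Fin N → ℝ → 𝕜) : ℝ :=
  1 / 2 * starKinetic u - 1 / p * (∑ i, ∫ x in Ioi 0, ‖u i x‖ ^ p) - 1 / q * ‖u 0 0‖ ^ q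

/-- `ℱ_{p,q}(m) = inf {F_{p,q}(u) : u ∈ H¹_m(S_N)}`, the infimum being taken in the extended
reals. -/
def starLevel (𝕜 : Type*) [RCLike 𝕜] (N : ℕ) [NeZero N] (p q m : ℝ) : EReal :=
  ⨅ u ∈ H1MassStar 𝕜 N m, (starEnergy p q u : EReal)

/-- `u` is a ground state of `F_{p,q}` at mass `m`. -/
def IsGroundState {𝕜 : Type*} [RCLike 𝕜] {N : ℕ} [NeZero N] (p q m : ℝ)
    (u : Fin N → ℝ → 𝕜) : Prop :=
  u ∈ H1MassStar 𝕜 N m ∧ (starEnergy p q u : EReal) = starLevel 𝕜 N p q m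

/-- `(w n)` is a minimizing sequence of `F_{p,q}` at mass `m`. -/
def IsMinimizingSeq {𝕜 : Type*} [RCLike 𝕜] {N : ℕ} [NeZero N] (p q m : ℝ)
    (w : ℕ → Fin N → ℝ → 𝕜) : Prop :=
  (∀ n, w n ∈ H1MassStar 𝕜 N m) ∧
    Tendsto (fun n => (starEnergy p q (w n) : EReal)) atTop (𝓝 (starLevel 𝕜 N p q m))

end

end StarNLS

/-! ### Weak derivatives on an interval and the du Bois-Reymond lemma -/

namespace StarNLS

/-! The inequality between the levels comes from running away along one half-line. A competitor on
the line is translated by `n`, restricted to one half-line, continued on the others by exponentials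
matching its small value at the vertex, and rescaled to mass `m`. The vertex term and the
exponential tails disappear in the limit (`exists_seq_tendsto_lineEnergy`).

Compactness is a concentration argument on a fixed graph, where only the weak limit has to be
examined. Since `p < 6` and `q < 4`, a Gagliardo–Nirenberg estimate bounds a minimizing sequence in
`H¹` (`exists_starKinetic_le_starEnergy`). Along a subsequence it has a limit `u`, and mass, kinetic
and potential energy split between `u` and the remainder `w n - u`, whose vertex value tends to zero
(`exists_subseq_splitsTo`). The mass of `u` decides the rest.

If it is zero, the vertex values tend to zero. Extending each branch to the line by a small
exponential tail gives `N` functions of total mass close to `m`; each has at least its proportional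
share of any lower bound `e` for the line energy at mass `m`, so the limiting energy is at least `e`
(`le_of_tendsto_vertex_zero`). This contradicts the strict inequality of levels.

If it lies strictly between `0` and `m`, multiplying up to mass `m` shows that each part has at
least its proportional share of the infimum, and `u` strictly more because the nonlinear terms are
superquadratic. The sum then exceeds the infimum (`SplitsTo.not_dichotomy`).

So `u` has mass `m`. Convergence is strong in `L²`, hence in `L^p` by the uniform bound, and
minimality of the level forces convergence of the kinetic energy (`SplitsTo.strong_of_starMass_eq`).
Existence of a ground state follows by applying this to any minimizing sequence. -/

theorem integral_deriv_smul_integral_Iic {𝕜 : Type*} [RCLike 𝕜] {g : ℝ → 𝕜} (hg : Integrable g)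
    {φ : ℝ → ℝ} (hφ : ContDiff ℝ 1 φ) (hc : HasCompactSupport φ) :
    ∫ x, deriv φ x • ∫ y in Iic x, g y = -∫ x, φ x • g x := by
  have hd : Integrable (deriv φ) :=
    (hφ.continuous_deriv le_rfl).integrable_of_hasCompactSupport hc.deriv
  have hS : MeasurableSet {z : ℝ × ℝ | z.2 ≤ z.1} := measurableSet_le measurable_snd measurable_fst
  have hint : Integrable (Function.uncurry fun x y => (Iic x).indicator (fun y => deriv φ x • g y) y)
      ((volume : Measure ℝ).prod (volume : Measure ℝ)) := by
    refine ((hd.smul_prod hg).indicator hS).congr (ae_of_all _ fun z => ?_)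
    rcases z with ⟨x, y⟩
    simp [indicator, Function.uncurry]
  calc ∫ x, deriv φ x • ∫ y in Iic x, g y
      = ∫ x, ∫ y, (Iic x).indicator (fun y => deriv φ x • g y) y := by
        congr 1; ext x
        rw [integral_indicator measurableSet_Iic, integral_smul]
    _ = ∫ y, ∫ x, (Iic x).indicator (fun y => deriv φ x • g y) y := integral_integral_swap hint
    _ = ∫ y, -(φ y • g y) := by
        congr 1; ext y
        have : (fun x => (Iic x).indicator (fun y => deriv φ x • g y) y)
            = (Ici y).indicator (fun x => deriv φ x • g y) := by
          ext x; simp [indicator]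
        rw [this, integral_indicator measurableSet_Ici, integral_smul_const,
          integral_Ici_eq_integral_Ioi, hc.integral_Ioi_deriv_eq hφ, neg_smul]
    _ = _ := integral_neg _

theorem integral_deriv_eq_zero_of_hasCompactSupport {φ : ℝ → ℝ} (hφ : ContDiff ℝ 1 φ)
    (hc : HasCompactSupport φ) : ∫ x, deriv φ x = 0 :=
  integral_eq_zero_of_hasDerivAt_of_integrable
    (fun x => (hφ.differentiable one_ne_zero x).hasDerivAt)
    ((hφ.continuous_deriv le_rfl).integrable_of_hasCompactSupport hc.deriv)
    (hφ.continuous.integrable_of_hasCompactSupport hc)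

/-- Cutting `g` off outside an interval containing the support of `φ` reduces this to the integrable
case. The change of base point adds a constant to the primitive, which is invisible because `deriv
φ` has zero mean. -/
theorem integral_deriv_smul_primitive {𝕜 : Type*} [RCLike 𝕜] {g : ℝ → 𝕜}
    (hg : LocallyIntegrable g) {φ : ℝ → ℝ} (hφ : ContDiff ℝ 1 φ) (hc : HasCompactSupport φ) :
    ∫ x, deriv φ x • ∫ y in (0 : ℝ)..x, g y = -∫ x, φ x • g x := by
  obtain ⟨R, hR⟩ := hc.isCompact.isBounded.subset_closedBall (0 : ℝ)
  rw [Real.closedBall_eq_Icc, zero_sub, zero_add] at hR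
  have hii : ∀ a b, IntervalIntegrable g volume a b := fun a b =>
    (hg.integrableOn_isCompact isCompact_uIcc).intervalIntegrable
  set h := (Icc (-R) R).indicator g with hh
  have hint : Integrable h := (hg.integrableOn_isCompact isCompact_Icc).integrable_indicator
    measurableSet_Icc
  have hd : Integrable (deriv φ) :=
    (hφ.continuous_deriv le_rfl).integrable_of_hasCompactSupport hc.deriv
  have key : ∀ x, deriv φ x • ∫ y in (0 : ℝ)..x, g y
      = deriv φ x • (∫ y in Iic x, h y) + deriv φ x • ∫ y in (0 : ℝ)..(-R), g y := by
    intro x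
    by_cases hx : x ∈ Icc (-R) R
    · have : ∫ y in Iic x, h y = ∫ y in (-R)..x, g y := by
        rw [hh, setIntegral_indicator measurableSet_Icc, intervalIntegral.integral_of_le hx.1,
          ← integral_Icc_eq_integral_Ioc]
        congr 2
        ext y; simp only [mem_inter_iff, mem_Iic, mem_Icc]
        exact ⟨fun h => ⟨h.2.1, h.1⟩, fun h => ⟨h.2, h.1, h.2.trans hx.2⟩⟩
      rw [this, ← smul_add, add_comm, intervalIntegral.integral_add_adjacent_intervals (hii _ _)
        (hii _ _)]
    · have : deriv φ x = 0 := by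
        by_contra h0
        exact hx (hR (tsupport_deriv_subset (f := φ) (subset_tsupport _ h0)))
      simp [this]
  simp_rw [key]
  have hbd : Integrable fun x => deriv φ x • ∫ y in Iic x, h y := by
    refine Integrable.smul_of_top_left hd (memLp_top_of_bound (C := ∫ y, ‖h y‖) ?_ (ae_of_all _ fun x => ?_))
    · have : Continuous fun x => ∫ y in Iic x, h y := by
        have h0 : (fun x => ∫ y in Iic x, h y)
            = fun x => (∫ y in Iic (0:ℝ), h y) + ∫ y in (0:ℝ)..x, h y := by
          ext x
          rw [← intervalIntegral.integral_Iic_sub_Iic hint.integrableOn hint.integrableOn]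
          ring
        rw [h0]
        exact continuous_const.add (intervalIntegral.continuous_primitive
          (fun _ _ => hint.intervalIntegrable) 0)
      exact this.aestronglyMeasurable
    · exact (norm_integral_le_integral_norm _).trans
        (setIntegral_le_integral hint.norm (ae_of_all _ fun _ => norm_nonneg _))
  rw [integral_add hbd (hd.smul_const _), integral_deriv_smul_integral_Iic hint hφ hc,
    integral_smul_const, integral_deriv_eq_zero_of_hasCompactSupport hφ hc, zero_smul, add_zero]
  congr 2
  ext x
  by_cases hx : x ∈ Icc (-R) R
  · simp [hh, hx]
  · have : φ x = 0 := by
      by_contra h0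
      exact hx (hR (subset_tsupport _ h0))
    simp [this]

/-- A test function with zero mean is the derivative of a test function. -/
theorem exists_deriv_eq_of_integral_eq_zero {Ω : Set ℝ} (hΩ : Ω.OrdConnected) {φ : ℝ → ℝ}
    (hφ : ContDiff ℝ ∞ φ) (hc : HasCompactSupport φ) (hs : tsupport φ ⊆ Ω) (h0 : ∫ x, φ x = 0) :
    ∃ ψ : ℝ → ℝ, ContDiff ℝ ∞ ψ ∧ HasCompactSupport ψ ∧ tsupport ψ ⊆ Ω ∧ deriv ψ = φ := by
  rcases (tsupport φ).eq_empty_or_nonempty with he | hne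
  · have : φ = 0 := by
      rwa [tsupport_eq_empty_iff] at he
    subst this
    refine ⟨0, contDiff_const, HasCompactSupport.zero, by simp, ?_⟩
    ext x; simp
  have hcpt : IsCompact (tsupport φ) := hc
  set a := sInf (tsupport φ)
  set b := sSup (tsupport φ)
  have ha : a ∈ tsupport φ := hcpt.sInf_mem hne
  have hb : b ∈ tsupport φ := hcpt.sSup_mem hne
  have hab : tsupport φ ⊆ Icc a b := fun x hx =>
    ⟨csInf_le hcpt.bddBelow hx, le_csSup hcpt.bddAbove hx⟩
  have hz : ∀ x, x ∉ Icc a b → φ x = 0 := fun x hx => by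
    by_contra h
    exact hx (hab (subset_tsupport _ h))
  set ψ : ℝ → ℝ := fun x => ∫ y in a..x, φ y with hψ
  have hder : ∀ x, HasDerivAt ψ (φ x) x := fun x =>
    intervalIntegral.integral_hasDerivAt_right (hφ.continuous.intervalIntegrable _ _)
      (hφ.continuous.stronglyMeasurableAtFilter _ _) hφ.continuous.continuousAt
  have hd : deriv ψ = φ := funext fun x => (hder x).deriv
  have hsupp : Function.support ψ ⊆ Icc a b := by
    intro x hx
    by_contra hxn
    apply hx
    rw [mem_Icc, not_and_or, not_le, not_le] at hxn
    rcases hxn with h | h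
    · simp only [hψ]
      rw [intervalIntegral.integral_symm, intervalIntegral.integral_of_le h.le, neg_eq_zero,
        ← integral_Ico_eq_integral_Ioc]
      exact setIntegral_eq_zero_of_forall_eq_zero fun y hy => hz y fun hy' => absurd hy.2 (not_lt.2 hy'.1)
    -- To the right of the support the primitive is the whole integral of `φ`; this is where the
    -- zero mean is used.
    · simp only [hψ]
      have hle : a ≤ x := (hab hb).1.trans h.le
      rw [intervalIntegral.integral_of_le hle, ← integral_Icc_eq_integral_Ioc,
        setIntegral_eq_integral_of_forall_compl_eq_zero, h0]
      intro y hy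
      exact hz y fun hy' => hy ⟨hy'.1, hy'.2.trans h.le⟩
  have hts : tsupport ψ ⊆ Icc a b := closure_minimal hsupp isClosed_Icc
  refine ⟨ψ, ?_, HasCompactSupport.of_support_subset_isCompact isCompact_Icc hsupp,
    hts.trans (hΩ.out (hs ha) (hs hb)), hd⟩
  rw [contDiff_infty_iff_deriv, hd]
  exact ⟨fun x => (hder x).differentiableAt, hφ⟩

theorem exists_test_function_integral_eq_one {Ω : Set ℝ} (hΩ : IsOpen Ω) (hne : Ω.Nonempty) :
    ∃ ψ : ℝ → ℝ, ContDiff ℝ ∞ ψ ∧ HasCompactSupport ψ ∧ tsupport ψ ⊆ Ω ∧ ∫ x, ψ x = 1 := by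
  obtain ⟨c, hcΩ⟩ := hne
  obtain ⟨ε, hε, hball⟩ := Metric.isOpen_iff.1 hΩ c hcΩ
  let f : ContDiffBump c := ⟨ε / 4, ε / 2, by positivity, by linarith⟩
  refine ⟨f.normed volume, f.contDiff_normed, f.hasCompactSupport_normed, ?_, f.integral_normed⟩
  rw [f.tsupport_normed_eq]
  exact (Metric.closedBall_subset_ball (by change ε / 2 < ε; linarith)).trans hball

theorem setIntegral_smul_eq_integral {𝕜 : Type*} [RCLike 𝕜] {Ω : Set ℝ} {φ : ℝ → ℝ}
    (hs : tsupport φ ⊆ Ω) (w : ℝ → 𝕜) : ∫ x in Ω, φ x • w x = ∫ x, φ x • w x := by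
  apply setIntegral_eq_integral_of_forall_compl_eq_zero
  intro x hx
  have : φ x = 0 := by
    by_contra h
    exact hx (hs (subset_tsupport _ h))
  simp [this]

theorem LocallyIntegrableOn.integrable_test_smul {𝕜 : Type*} [RCLike 𝕜] {Ω : Set ℝ}
    {w : ℝ → 𝕜} (hw : LocallyIntegrableOn w Ω) {φ : ℝ → ℝ} (hφ : Continuous φ)
    (hc : HasCompactSupport φ) (hs : tsupport φ ⊆ Ω) :
    Integrable fun x => φ x • w x := by
  have h1 : IntegrableOn w (tsupport φ) := hw.integrableOn_compact_subset hs hc.isCompact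
  have h2 : IntegrableOn (fun x => φ x • w x) (tsupport φ) := by
    obtain ⟨C, hC⟩ := hc.exists_bound_of_continuous hφ
    exact Integrable.smul_of_top_right h1
      (memLp_top_of_bound hφ.aestronglyMeasurable C (ae_of_all _ hC))
  rwa [integrableOn_iff_integrable_of_support_subset] at h2
  intro x hx
  apply subset_tsupport
  intro h
  simp [h] at hx

/-- The lemma of du Bois-Reymond. -/
theorem ae_eq_const_of_isWeakDeriv_zero {𝕜 : Type*} [RCLike 𝕜] {Ω : Set ℝ} (hΩ : IsOpen Ω)
    (hne : Ω.Nonempty) (hconn : Ω.OrdConnected) {w : ℝ → 𝕜} (hw : LocallyIntegrableOn w Ω)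
    (h : ∀ φ : ℝ → ℝ, ContDiff ℝ ∞ φ → HasCompactSupport φ → tsupport φ ⊆ Ω →
      ∫ x, deriv φ x • w x = 0) :
    ∃ c : 𝕜, w =ᵐ[volume.restrict Ω] fun _ => c := by
  obtain ⟨ψ, hψ, hψc, hψs, hψ1⟩ := exists_test_function_integral_eq_one hΩ hne
  -- Since `ψ` has integral one, this is the only possible value of the constant.
  refine ⟨∫ x, ψ x • w x, ?_⟩
  set c := ∫ x, ψ x • w x
  have hmain := hΩ.ae_eq_zero_of_integral_contDiff_smul_eq_zero
    (f := fun x => w x - c) (μ := volume) (hw.sub (locallyIntegrable_const c |>.locallyIntegrableOn _)) ?_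
  · rw [Filter.EventuallyEq, ae_restrict_iff' hΩ.measurableSet]
    filter_upwards [hmain] with x hx hxΩ
    exact sub_eq_zero.1 (hx hxΩ)
  intro φ hφ hφc hφs
  have iφ := hφ.continuous.integrable_of_hasCompactSupport (μ := volume) hφc
  have iψ := hψ.continuous.integrable_of_hasCompactSupport (μ := volume) hψc
  have jφ := LocallyIntegrableOn.integrable_test_smul hw hφ.continuous hφc hφs
  have jψ := LocallyIntegrableOn.integrable_test_smul hw hψ.continuous hψc hψs
  set I := ∫ x, φ x with hI
  have hts : tsupport (fun x => φ x - I * ψ x) ⊆ tsupport φ ∪ tsupport ψ := by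
    refine closure_minimal (fun x hx => ?_) (isClosed_closure.union isClosed_closure)
    by_contra hn
    rw [mem_union, not_or] at hn
    have h1 : φ x = 0 := image_eq_zero_of_notMem_tsupport hn.1
    have h2 : ψ x = 0 := image_eq_zero_of_notMem_tsupport hn.2
    simp [h1, h2] at hx
  -- Removing `I * ψ` makes the mean of `φ` zero, so the difference is an admissible derivative and
  -- the hypothesis applies to it.
  obtain ⟨χ, hχ, hχc, hχs, hχd⟩ := exists_deriv_eq_of_integral_eq_zero hconn
    (φ := fun x => φ x - I * ψ x) (hφ.sub (contDiff_const.mul hψ))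
    (HasCompactSupport.of_support_subset_isCompact (hφc.isCompact.union hψc.isCompact)
      ((subset_tsupport _).trans hts)) (hts.trans (union_subset hφs hψs)) (by
        rw [integral_sub iφ (iψ.const_mul I), integral_const_mul, hψ1]; simp [hI])
  have h3 := h χ hχ hχc hχs
  rw [hχd] at h3
  simp_rw [sub_smul, mul_smul] at h3
  rw [integral_sub jφ (show Integrable fun x => I • ψ x • w x from jψ.smul I), integral_smul] at h3
  simp_rw [smul_sub]
  rw [integral_sub jφ (iφ.smul_const c), integral_smul_const]
  exact h3

/-- Uniqueness is what allows the derivative picked by choice in `weakDeriv` to be replaced by an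
explicit one. -/
theorem ae_eq_of_isWeakDeriv {𝕜 : Type*} [RCLike 𝕜] {Ω : Set ℝ} (hΩ : IsOpen Ω)
    {u g g' : ℝ → 𝕜} (hg : LocallyIntegrableOn g Ω) (hg' : LocallyIntegrableOn g' Ω)
    (h : IsWeakDeriv Ω u g) (h' : IsWeakDeriv Ω u g') : g =ᵐ[volume.restrict Ω] g' := by
  have := hΩ.ae_eq_zero_of_integral_contDiff_smul_eq_zero (f := fun x => g x - g' x) (μ := volume)
    (hg.sub hg') (fun φ hφ hc hs => by
      simp_rw [smul_sub]
      rw [integral_sub (LocallyIntegrableOn.integrable_test_smul hg hφ.continuous hc hs)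
        (LocallyIntegrableOn.integrable_test_smul hg' hφ.continuous hc hs),
        ← setIntegral_smul_eq_integral hs, ← setIntegral_smul_eq_integral hs, sub_eq_zero,
        ← neg_inj, ← h φ hφ hc hs, ← h' φ hφ hc hs])
  rw [Filter.EventuallyEq, ae_restrict_iff' hΩ.measurableSet]
  filter_upwards [this] with x hx hxΩ
  exact sub_eq_zero.1 (hx hxΩ)

end StarNLS

/-! ### Absolutely continuous representatives and the Sobolev inequality -/

namespace StarNLS

/-- An open interval that contains every segment from the origin to a point of its closure. -/
structure IsBasedInterval (Ω : Set ℝ) : Prop where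
  isOpen : IsOpen Ω
  nonempty : Ω.Nonempty
  ordConnected : Ω.OrdConnected
  uIoc_subset : ∀ x ∈ closure Ω, uIoc 0 x ⊆ Ω

theorem isBasedInterval_univ : IsBasedInterval univ :=
  ⟨isOpen_univ, univ_nonempty, ordConnected_univ, fun _ _ => subset_univ _⟩

theorem isBasedInterval_Ioi : IsBasedInterval (Ioi 0) := by
  refine ⟨isOpen_Ioi, nonempty_Ioi, ordConnected_Ioi, fun x hx => ?_⟩
  rw [closure_Ioi, mem_Ici] at hx
  rw [uIoc_of_le hx]
  exact fun y hy => hy.1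

/-- `u` is the primitive of `g` on the closure of `Ω`, and both are square integrable on `Ω`. -/
structure IsH1Pair {𝕜 : Type*} [RCLike 𝕜] (Ω : Set ℝ) (u g : ℝ → 𝕜) : Prop where
  memLp : MemLp u 2 (volume.restrict Ω)
  memLp_deriv : MemLp g 2 (volume.restrict Ω)
  ftc : ∀ x ∈ closure Ω, u x = u 0 + ∫ y in (0 : ℝ)..x, g y

section

variable {𝕜 : Type*} [RCLike 𝕜] {Ω : Set ℝ} {u g : ℝ → 𝕜}

theorem locallyIntegrable_indicator_of_memLp (hΩ : MeasurableSet Ω)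
    (hg : MemLp g 2 (volume.restrict Ω)) : LocallyIntegrable (Ω.indicator g) :=
  ((memLp_indicator_iff_restrict hΩ).2 hg).locallyIntegrable one_le_two

theorem locallyIntegrableOn_of_memLp (hΩ : MeasurableSet Ω)
    (hg : MemLp g 2 (volume.restrict Ω)) : LocallyIntegrableOn g Ω := by
  have h := (locallyIntegrable_indicator_of_memLp hΩ hg).locallyIntegrableOn Ω
  intro x hx
  obtain ⟨s, hs, hs'⟩ := h x hx
  refine ⟨s ∩ Ω, inter_mem hs self_mem_nhdsWithin, ?_⟩
  have h2 := hs'.mono_set (inter_subset_left (t := Ω))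
  refine h2.congr_fun_ae ?_
  have := ae_restrict_of_ae_restrict_of_subset (μ := volume) (inter_subset_right : s ∩ Ω ⊆ Ω)
    (ae_restrict_of_forall_mem hΩ (p := fun x => Ω.indicator g x = g x) fun x hx => by simp [hx])
  exact this

theorem IsBasedInterval.integral_indicator (hΩ : IsBasedInterval Ω) (g : ℝ → 𝕜) {x : ℝ}
    (hx : x ∈ closure Ω) :
    ∫ y in (0 : ℝ)..x, Ω.indicator g y = ∫ y in (0 : ℝ)..x, g y := by
  apply intervalIntegral.integral_congr_ae
  exact ae_of_all _ fun y hy => indicator_of_mem (hΩ.uIoc_subset x hx hy) g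

theorem IsBasedInterval.intervalIntegrable (hΩ : IsBasedInterval Ω)
    (hg : MemLp g 2 (volume.restrict Ω)) {x : ℝ} (hx : x ∈ closure Ω) :
    IntervalIntegrable g volume 0 x := by
  have h1 : IntervalIntegrable (Ω.indicator g) volume 0 x :=
    ((locallyIntegrable_indicator_of_memLp hΩ.isOpen.measurableSet hg).integrableOn_isCompact
      isCompact_uIcc).intervalIntegrable
  exact h1.congr fun w hw => indicator_of_mem (hΩ.uIoc_subset x hx hw) g

/-- Both terms integrate by parts to the same quantity. The indicator makes the primitive a
continuous function on the whole line, even though `g` is controlled only on `Ω`. -/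
theorem IsWeakDeriv.integral_deriv_smul_sub_primitive (hΩ : IsBasedInterval Ω)
    (hu : LocallyIntegrableOn u Ω) (hg : MemLp g 2 (volume.restrict Ω)) (h : IsWeakDeriv Ω u g)
    {φ : ℝ → ℝ} (hφ : ContDiff ℝ ∞ φ) (hc : HasCompactSupport φ) (hs : tsupport φ ⊆ Ω) :
    ∫ x, deriv φ x • (u x - ∫ y in (0 : ℝ)..x, Ω.indicator g y) = 0 := by
  have hl := locallyIntegrable_indicator_of_memLp hΩ.isOpen.measurableSet hg
  have hφ1 : ContDiff ℝ 1 φ := hφ.of_le (by norm_cast)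
  have hd := hφ1.continuous_deriv le_rfl
  have hds : tsupport (deriv φ) ⊆ Ω := tsupport_deriv_subset.trans hs
  have hcont : Continuous fun x => ∫ y in (0 : ℝ)..x, Ω.indicator g y :=
    intervalIntegral.continuous_primitive
      (fun _ _ => (hl.integrableOn_isCompact isCompact_uIcc).intervalIntegrable) 0
  simp_rw [smul_sub]
  rw [integral_sub (LocallyIntegrableOn.integrable_test_smul hu hd hc.deriv hds)
      (LocallyIntegrableOn.integrable_test_smul
        (hcont.locallyIntegrable.locallyIntegrableOn _) hd hc.deriv hds),
    integral_deriv_smul_primitive hl hφ1 hc, ← setIntegral_smul_eq_integral hds, h φ hφ hc hs,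
    sub_neg_eq_add, neg_add_eq_zero, ← MeasureTheory.integral_indicator hΩ.isOpen.measurableSet]
  congr 1; ext x
  by_cases hx : x ∈ Ω <;> simp [hx]

theorem IsH1Pair.isWeakDeriv (hΩ : IsBasedInterval Ω) (h : IsH1Pair Ω u g) :
    IsWeakDeriv Ω u g := by
  intro φ hφ hc hs
  have hl := locallyIntegrable_indicator_of_memLp hΩ.isOpen.measurableSet h.memLp_deriv
  have hφ1 : ContDiff ℝ 1 φ := hφ.of_le (by norm_cast)
  have hd := hφ1.continuous_deriv le_rfl
  have hds : tsupport (deriv φ) ⊆ Ω := tsupport_deriv_subset.trans hs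
  have hcont : Continuous fun x => ∫ y in (0 : ℝ)..x, Ω.indicator g y :=
    intervalIntegral.continuous_primitive
      (fun _ _ => (hl.integrableOn_isCompact isCompact_uIcc).intervalIntegrable) 0
  have e1 : ∫ x in Ω, deriv φ x • u x
      = ∫ x in Ω, deriv φ x • (u 0 + ∫ y in (0 : ℝ)..x, Ω.indicator g y) := by
    refine setIntegral_congr_fun hΩ.isOpen.measurableSet fun x hx => ?_
    rw [hΩ.integral_indicator g (subset_closure hx), ← h.ftc x (subset_closure hx)]
  rw [e1, setIntegral_smul_eq_integral hds]
  simp_rw [smul_add]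
  rw [integral_add ((hd.integrable_of_hasCompactSupport hc.deriv).smul_const _)
    (LocallyIntegrableOn.integrable_test_smul
        (hcont.locallyIntegrable.locallyIntegrableOn _) hd hc.deriv hds),
    integral_smul_const, integral_deriv_eq_zero_of_hasCompactSupport hφ1 hc, zero_smul, zero_add,
    integral_deriv_smul_primitive hl hφ1 hc, ← MeasureTheory.integral_indicator hΩ.isOpen.measurableSet]
  congr 2; ext x
  by_cases hx : x ∈ Ω <;> simp [hx]

theorem IsH1Pair.memH1 (hΩ : IsBasedInterval Ω) (h : IsH1Pair Ω u g) : MemH1 Ω u :=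
  ⟨h.memLp, g, h.memLp_deriv, h.isWeakDeriv hΩ⟩

theorem MemH1.memLp_weakDeriv (h : MemH1 Ω u) : MemLp (weakDeriv Ω u) 2 (volume.restrict Ω) := by
  rw [weakDeriv, dif_pos h]
  exact h.2.choose_spec.1

theorem MemH1.isWeakDeriv_weakDeriv (h : MemH1 Ω u) : IsWeakDeriv Ω u (weakDeriv Ω u) := by
  rw [weakDeriv, dif_pos h]
  exact h.2.choose_spec.2

theorem IsH1Pair.weakDeriv_ae_eq (hΩ : IsBasedInterval Ω) (h : IsH1Pair Ω u g) :
    weakDeriv Ω u =ᵐ[volume.restrict Ω] g :=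
  have hm := hΩ.isOpen.measurableSet
  ae_eq_of_isWeakDeriv hΩ.isOpen (locallyIntegrableOn_of_memLp hm (h.memH1 hΩ).memLp_weakDeriv)
    (locallyIntegrableOn_of_memLp hm h.memLp_deriv) (h.memH1 hΩ).isWeakDeriv_weakDeriv
    (h.isWeakDeriv hΩ)

/-- Every `H¹` function has an absolutely continuous representative. -/
theorem MemH1.exists_isH1Pair (hΩ : IsBasedInterval Ω) (h : MemH1 Ω u) :
    ∃ v, v =ᵐ[volume.restrict Ω] u ∧ IsH1Pair Ω v (weakDeriv Ω u) := by
  have hm := hΩ.isOpen.measurableSet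
  have hg := h.memLp_weakDeriv
  have hl := locallyIntegrable_indicator_of_memLp hm hg
  have hcont : Continuous fun x => ∫ y in (0 : ℝ)..x, Ω.indicator (weakDeriv Ω u) y :=
    intervalIntegral.continuous_primitive
      (fun _ _ => (hl.integrableOn_isCompact isCompact_uIcc).intervalIntegrable) 0
  have hu := locallyIntegrableOn_of_memLp hm h.1
  obtain ⟨c, hc⟩ := ae_eq_const_of_isWeakDeriv_zero hΩ.isOpen hΩ.nonempty hΩ.ordConnected
    (hu.sub (hcont.locallyIntegrable.locallyIntegrableOn _)) fun φ hφ hφc hφs =>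
      h.isWeakDeriv_weakDeriv.integral_deriv_smul_sub_primitive hΩ hu hg hφ hφc hφs
  have hae : (fun x => c + ∫ y in (0 : ℝ)..x, weakDeriv Ω u y) =ᵐ[volume.restrict Ω] u := by
    filter_upwards [hc, ae_restrict_mem hm] with x hx hxΩ
    rw [← hx]
    simp [hΩ.integral_indicator _ (subset_closure hxΩ)]
  refine ⟨_, hae, (memLp_congr_ae hae).2 h.1, hg, fun x _ => by simp⟩

theorem IsH1Pair.continuousOn (hΩ : IsBasedInterval Ω) (h : IsH1Pair Ω u g) :
    ContinuousOn u (closure Ω) := by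
  have hl := locallyIntegrable_indicator_of_memLp hΩ.isOpen.measurableSet h.memLp_deriv
  have hcont : Continuous fun x => u 0 + ∫ y in (0 : ℝ)..x, Ω.indicator g y :=
    continuous_const.add (intervalIntegral.continuous_primitive
      (fun _ _ => (hl.integrableOn_isCompact isCompact_uIcc).intervalIntegrable) 0)
  refine hcont.continuousOn.congr fun x hx => ?_
  simp only [hΩ.integral_indicator g hx, h.ftc x hx]

/-- Continuity up to the endpoint selects the absolutely continuous representative itself, so that
pointwise values, in particular at the vertex, are meaningful. -/
theorem MemH1.isH1Pair (h : MemH1 (Ioi 0) u) (hc : ContinuousOn u (Ici 0)) :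
    IsH1Pair (Ioi 0) u (weakDeriv (Ioi 0) u) := by
  obtain ⟨v, hv, hp⟩ := h.exists_isH1Pair isBasedInterval_Ioi
  have hvc := hp.continuousOn isBasedInterval_Ioi
  rw [closure_Ioi] at hvc
  have heq : EqOn v u (Ici 0) := by
    refine Measure.eqOn_of_ae_eq (μ := volume) ?_ hvc hc (by simp)
    rwa [Measure.restrict_congr_set Ioi_ae_eq_Ici.symm]
  refine ⟨h.1, h.memLp_weakDeriv, fun x hx => ?_⟩
  rw [← heq self_mem_Ici, ← hp.ftc x hx, heq (by simpa using hx)]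

theorem IsH1Pair.sub {u' g' : ℝ → 𝕜} (hΩ : IsBasedInterval Ω) (h : IsH1Pair Ω u g)
    (h' : IsH1Pair Ω u' g') :
    IsH1Pair Ω (u - u') (g - g') := by
  refine ⟨h.memLp.sub h'.memLp, h.memLp_deriv.sub h'.memLp_deriv, fun x hx => ?_⟩
  simp only [Pi.sub_apply]
  rw [intervalIntegral.integral_sub (hΩ.intervalIntegrable h.memLp_deriv hx)
    (hΩ.intervalIntegrable h'.memLp_deriv hx), h.ftc x hx, h'.ftc x hx]
  ring

theorem IsH1Pair.smul (h : IsH1Pair Ω u g) (c : ℝ) : IsH1Pair Ω (c • u) (c • g) := by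
  refine ⟨h.memLp.const_smul c, h.memLp_deriv.const_smul c, fun x hx => ?_⟩
  simp only [Pi.smul_apply]
  rw [intervalIntegral.integral_smul, h.ftc x hx, smul_add]

theorem integrable_sq_of_memLp {μ : Measure ℝ} {f : ℝ → 𝕜} (h : MemLp f 2 μ) :
    Integrable (fun x => ‖f x‖ ^ 2) μ := by
  simpa using h.norm.integrable_sq

theorem sq_setIntegral_norm_le {a h : ℝ} (hh : 0 < h)
    (hg : MemLp g 2 (volume.restrict (Ioc a (a + h)))) :
    (∫ x in Ioc a (a + h), ‖g x‖) ^ 2 ≤ h * ∫ x in Ioc a (a + h), ‖g x‖ ^ 2 := by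
  have h1 : IntegrableOn (fun x => ‖g x‖) (Ioc a (a + h)) := (hg.integrable one_le_two).norm
  have h2 : IntegrableOn (fun x => ‖g x‖ ^ 2) (Ioc a (a + h)) := integrable_sq_of_memLp hg
  set I := ∫ x in Ioc a (a + h), ‖g x‖
  -- Cauchy–Schwarz in variance form: subtract from `‖g‖` its mean over the interval.
  have h3 : 0 ≤ ∫ x in Ioc a (a + h), (‖g x‖ - I / h) ^ 2 := integral_nonneg fun _ => sq_nonneg _
  have h4 : ∫ x in Ioc a (a + h), (‖g x‖ - I / h) ^ 2
      = (∫ x in Ioc a (a + h), ‖g x‖ ^ 2) - I ^ 2 / h := by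
    have : ∀ x, (‖g x‖ - I / h) ^ 2 = ‖g x‖ ^ 2 - (2 * (I / h)) * ‖g x‖ + (I / h) ^ 2 := by
      intro x; ring
    simp_rw [this]
    rw [integral_add (f := fun x => ‖g x‖ ^ 2 - (2 * (I / h)) * ‖g x‖)
      (Integrable.sub h2 (Integrable.const_mul h1 _)) (integrable_const _),
      integral_sub h2 (h1.const_mul _), integral_const_mul]
    simp only [integral_const, measureReal_restrict_apply_univ, Real.volume_real_Ioc,
      add_sub_cancel_left, max_eq_left hh.le, smul_eq_mul]
    field_simp
    ring
  rw [h4, sub_nonneg, div_le_iff₀ hh] at h3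
  linarith

/-- Local form of the one-dimensional Sobolev inequality. -/
theorem IsH1Pair.sq_norm_le_of_Ioc (hΩ : IsBasedInterval Ω) (hp : IsH1Pair Ω u g) {x h : ℝ}
    (hh : 0 < h) (hx : x ∈ closure Ω) (hsub : Ioc x (x + h) ⊆ Ω) :
    ‖u x‖ ^ 2 ≤ 2 / h * (∫ y in Ioc x (x + h), ‖u y‖ ^ 2)
      + 2 * h * ∫ y in Ioc x (x + h), ‖g y‖ ^ 2 := by
  have mu : MemLp u 2 (volume.restrict (Ioc x (x + h))) :=
    hp.memLp.mono_measure (Measure.restrict_mono_set _ hsub)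
  have mg : MemLp g 2 (volume.restrict (Ioc x (x + h))) :=
    hp.memLp_deriv.mono_measure (Measure.restrict_mono_set _ hsub)
  have ig := (mg.integrable one_le_two).norm
  have iu := integrable_sq_of_memLp mu
  set B := ∫ y in Ioc x (x + h), ‖g y‖ ^ 2
  have key : ∀ y ∈ Ioc x (x + h), ‖u x‖ ^ 2 ≤ 2 * ‖u y‖ ^ 2 + 2 * (h * B) := by
    intro y hy
    have hyc := subset_closure (hsub hy)
    have e : u x = u y - ∫ t in x..y, g t := by
      rw [hp.ftc x hx, hp.ftc y hyc, ← intervalIntegral.integral_interval_sub_left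
        (hΩ.intervalIntegrable hp.memLp_deriv hyc)
        (hΩ.intervalIntegrable hp.memLp_deriv hx)]
      ring
    have hn : ‖∫ t in x..y, g t‖ ≤ ∫ t in Ioc x (x + h), ‖g t‖ := by
      rw [intervalIntegral.integral_of_le hy.1.le]
      exact (norm_integral_le_integral_norm _).trans (setIntegral_mono_set ig
        (ae_of_all _ fun _ => norm_nonneg _) (Ioc_subset_Ioc_right hy.2).eventuallyLE)
    have h1 : ‖u x‖ ≤ ‖u y‖ + ∫ t in Ioc x (x + h), ‖g t‖ := by
      rw [e]; exact (norm_sub_le _ _).trans (by gcongr)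
    have h2 := sq_setIntegral_norm_le hh mg
    have h3 : ‖u x‖ ^ 2 ≤ (‖u y‖ + ∫ t in Ioc x (x + h), ‖g t‖) ^ 2 := by gcongr
    nlinarith [sq_nonneg (‖u y‖ - ∫ t in Ioc x (x + h), ‖g t‖)]
  -- Averaging the pointwise bound over `y` in the window turns `‖u y‖ ^ 2` into its integral
  -- divided by `h`.
  have hI := setIntegral_mono_on (μ := volume) (integrableOn_const (by simp) (by simp))
    ((iu.const_mul 2).add (integrable_const (2 * (h * B)))) measurableSet_Ioc key
  simp only [Pi.add_apply] at hI
  rw [integral_add (iu.const_mul 2) (integrable_const _), integral_const_mul] at hI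
  simp only [integral_const, measureReal_restrict_apply_univ, Real.volume_real_Ioc,
      add_sub_cancel_left, max_eq_left hh.le, smul_eq_mul] at hI
  rw [← mul_le_mul_iff_right₀ hh]
  refine hI.trans (le_of_eq ?_)
  field_simp

theorem IsH1Pair.sq_norm_le (hp : IsH1Pair (Ioi 0) u g) {x h : ℝ} (hh : 0 < h) (hx : 0 ≤ x) :
    ‖u x‖ ^ 2 ≤ 2 / h * (∫ y in Ioi 0, ‖u y‖ ^ 2) + 2 * h * ∫ y in Ioi 0, ‖g y‖ ^ 2 := by
  have hsub : Ioc x (x + h) ⊆ Ioi 0 := fun y hy => hx.trans_lt hy.1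
  refine (hp.sq_norm_le_of_Ioc isBasedInterval_Ioi hh (by simpa using hx) hsub).trans ?_
  gcongr 2 / h * ?_ + 2 * h * ?_
  · exact setIntegral_mono_set (integrable_sq_of_memLp hp.memLp)
      (ae_of_all _ fun _ => by positivity) hsub.eventuallyLE
  · exact setIntegral_mono_set (integrable_sq_of_memLp hp.memLp_deriv)
      (ae_of_all _ fun _ => by positivity) hsub.eventuallyLE

theorem tendsto_setIntegral_Iic_atBot {f : ℝ → ℝ} (hf : Integrable f) :
    Tendsto (fun x => ∫ y in Iic x, f y) atBot (𝓝 0) := by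
  have h := intervalIntegral_tendsto_integral_Iic 0 hf.integrableOn tendsto_id
  have h2 : Tendsto (fun x => (∫ y in Iic (0:ℝ), f y) - ∫ y in x..0, f y) atBot (𝓝 0) := by
    simpa using h.const_sub (∫ y in Iic (0:ℝ), f y)
  refine h2.congr fun x => ?_
  rw [← intervalIntegral.integral_Iic_sub_Iic hf.integrableOn hf.integrableOn]
  ring

theorem IsH1Pair.tendsto_atBot (hp : IsH1Pair univ u g) : Tendsto u atBot (𝓝 0) := by
  have iu : Integrable fun y => ‖u y‖ ^ 2 := by
    simpa using integrable_sq_of_memLp hp.memLp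
  have ig : Integrable fun y => ‖g y‖ ^ 2 := by
    simpa using integrable_sq_of_memLp hp.memLp_deriv
  have h1 : Tendsto (fun x : ℝ => x + 1) atBot atBot := tendsto_atBot_add_const_right _ _ tendsto_id
  have h2 := (((tendsto_setIntegral_Iic_atBot iu).comp h1).const_mul 2).add
    (((tendsto_setIntegral_Iic_atBot ig).comp h1).const_mul 2)
  simp only [Function.comp_def, mul_zero, add_zero] at h2
  have h3 : Tendsto (fun x => ‖u x‖ ^ 2) atBot (𝓝 0) := by
    refine squeeze_zero (fun _ => by positivity) (fun x => ?_) h2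
    refine (hp.sq_norm_le_of_Ioc isBasedInterval_univ one_pos (by simp) (subset_univ _)).trans ?_
    have hsub : Ioc x (x + 1) ⊆ Iic (x + 1) := fun y hy => hy.2
    rw [div_one, mul_one]
    gcongr 2 * ?_ + 2 * ?_
    · exact setIntegral_mono_set iu.integrableOn (ae_of_all _ fun _ => by positivity)
        hsub.eventuallyLE
    · exact setIntegral_mono_set ig.integrableOn (ae_of_all _ fun _ => by positivity)
        hsub.eventuallyLE
  rw [tendsto_zero_iff_norm_tendsto_zero]
  have h4 := h3.sqrt
  simpa [Real.sqrt_sq] using h4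

end

end StarNLS

/-! ### Brezis–Lieb splitting and weak compactness in `L²` -/

namespace StarNLS

/-- The mean value inequality for `x ^ (r / 2)` between `t ^ 2` and `s ^ 2`: as `r / 2 ≥ 1`, the
derivative is bounded on `[0, L ^ 2]`. -/
theorem abs_rpow_sub_rpow_le {r L s t : ℝ} (hr : 2 ≤ r) (hs : 0 ≤ s) (hsL : s ≤ L)
    (ht : 0 ≤ t) (htL : t ≤ L) :
    |s ^ r - t ^ r| ≤ r / 2 * (L ^ 2) ^ (r / 2 - 1) * ((s + t) * |s - t|) := by
  have hpow : ∀ x : ℝ, 0 ≤ x → x ^ r = (x ^ 2) ^ (r / 2) := fun x hx => by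
    rw [← Real.rpow_natCast, ← Real.rpow_mul hx]; congr 1; push_cast; ring
  have hbd := (convex_Icc (0 : ℝ) (L ^ 2)).norm_image_sub_le_of_norm_hasDerivWithin_le
    (f := fun x : ℝ => x ^ (r / 2)) (f' := fun x => r / 2 * x ^ (r / 2 - 1))
    (C := r / 2 * (L ^ 2) ^ (r / 2 - 1)) (x := t ^ 2) (y := s ^ 2)
    (fun x _ => (Real.hasDerivAt_rpow_const (Or.inr (by linarith))).hasDerivWithinAt)
    (fun x hx => by
      rw [Real.norm_of_nonneg (by have := hx.1; positivity)]
      gcongr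
      · exact hx.1
      · linarith
      · exact hx.2)
    ⟨by positivity, by gcongr⟩ ⟨by positivity, by gcongr⟩
  rw [hpow s hs, hpow t ht]
  refine hbd.trans (le_of_eq ?_)
  rw [Real.norm_eq_abs, show s ^ 2 - t ^ 2 = (s + t) * (s - t) by ring, abs_mul,
    abs_of_nonneg (add_nonneg hs ht)]

theorem rpow_le_mul_sq {r L s : ℝ} (hr : 2 ≤ r) (hs : 0 ≤ s) (hsL : s ≤ L) :
    s ^ r ≤ L ^ (r - 2) * s ^ 2 := by
  rcases hs.eq_or_lt with rfl | h
  · rw [Real.zero_rpow (by linarith)]; simp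
  · have : s ^ r = s ^ (r - 2) * s ^ 2 := by
      rw [← Real.rpow_natCast, ← Real.rpow_add h]; congr 1; push_cast; ring
    rw [this]
    gcongr

variable {𝕜 : Type*} [RCLike 𝕜] {μ : Measure ℝ}

theorem integrable_rpow_norm_of_bound {r M : ℝ} (hr : 2 ≤ r) {f : ℝ → 𝕜} (hf : MemLp f 2 μ)
    (hM : ∀ᵐ x ∂μ, ‖f x‖ ≤ M) : Integrable (fun x => ‖f x‖ ^ r) μ := by
  refine ((integrable_sq_of_memLp hf).const_mul (M ^ (r - 2))).mono'
    (hf.aestronglyMeasurable.norm.aemeasurable.pow_const r).aestronglyMeasurable ?_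
  filter_upwards [hM] with x hx
  rw [Real.norm_of_nonneg (by positivity)]
  exact rpow_le_mul_sq hr (norm_nonneg _) hx

theorem integral_rpow_norm_le {r M : ℝ} (hr : 2 ≤ r) {f : ℝ → 𝕜} (hf : MemLp f 2 μ)
    (hM : ∀ᵐ x ∂μ, ‖f x‖ ≤ M) : ∫ x, ‖f x‖ ^ r ∂μ ≤ M ^ (r - 2) * ∫ x, ‖f x‖ ^ 2 ∂μ := by
  rw [← integral_const_mul]
  refine integral_mono_ae (integrable_rpow_norm_of_bound hr hf hM)
    ((integrable_sq_of_memLp hf).const_mul _) ?_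
  filter_upwards [hM] with x hx
  exact rpow_le_mul_sq hr (norm_nonneg _) hx

/-- Convergence of integrals of functions controlled by a product of an `L²`-bounded sequence with
a fixed `L²` function. -/
theorem tendsto_integral_of_le_mul {D : ℕ → ℝ → ℝ} {F : ℕ → ℝ → ℝ} {f : ℝ → ℝ} {A C : ℝ}
    (hD : ∀ n, AEStronglyMeasurable (D n) μ) (hD0 : ∀ᵐ x ∂μ, Tendsto (fun n => D n x) atTop (𝓝 0))
    (hF : ∀ n, Integrable (fun x => F n x ^ 2) μ) (hFA : ∀ n, ∫ x, F n x ^ 2 ∂μ ≤ A)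
    (hf : Integrable (fun x => f x ^ 2) μ)
    (hle : ∀ n, ∀ᵐ x ∂μ, |D n x| ≤ C * (F n x * f x) + C * f x ^ 2) :
    Tendsto (fun n => ∫ x, D n x ∂μ) atTop (𝓝 0) := by
  have hA : 0 ≤ A := (integral_nonneg fun x => sq_nonneg (F 0 x)).trans (hFA 0)
  -- Young's inequality: the product costs a small multiple of the bounded sequence and a large
  -- multiple of the fixed function.
  have hle' : ∀ ε > 0, ∀ n, ∀ᵐ x ∂μ, |D n x| ≤ ε * F n x ^ 2 + (C ^ 2 / ε + |C|) * f x ^ 2 := by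
    intro ε hε n
    filter_upwards [hle n] with x hx
    refine hx.trans ?_
    have h1 : C * (F n x * f x) ≤ ε * F n x ^ 2 + C ^ 2 / ε * f x ^ 2 := by
      have h2 : 0 ≤ (ε * F n x - C * f x) ^ 2 := sq_nonneg _
      have h3 : 0 ≤ (ε * F n x) ^ 2 + (C * f x) ^ 2 := by positivity
      have h4 : ε * (C * (F n x * f x)) ≤ ε * (ε * F n x ^ 2 + C ^ 2 / ε * f x ^ 2) := by
        have : ε * (ε * F n x ^ 2 + C ^ 2 / ε * f x ^ 2) = (ε * F n x) ^ 2 + (C * f x) ^ 2 := by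
          field_simp
        rw [this]; nlinarith
      exact le_of_mul_le_mul_left h4 hε
    have h5 : C * f x ^ 2 ≤ |C| * f x ^ 2 := by gcongr; exact le_abs_self C
    linarith
  have hDi : ∀ n, Integrable (D n) μ := fun n =>
    (((hF n).const_mul 1).add (hf.const_mul (C ^ 2 / 1 + |C|))).mono' (hD n) (hle' 1 one_pos n)
  rw [Metric.tendsto_atTop]
  intro δ hδ
  set ε := δ / (2 * (A + 1)) with hεdef
  have hε : 0 < ε := by positivity
  have hεA : ε * A < δ / 2 := by
    rw [hεdef, div_mul_eq_mul_div, div_lt_div_iff₀ (by positivity) two_pos]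
    nlinarith
  -- The excess of `|D n|` over `ε * F n ^ 2` is dominated by a fixed integrable function; what is
  -- left is at most `ε * A`.
  have hW : Tendsto (fun n => ∫ x, max (|D n x| - ε * F n x ^ 2) 0 ∂μ) atTop (𝓝 0) := by
    have := tendsto_integral_of_dominated_convergence (μ := μ) (f := fun _ => (0 : ℝ))
      (F := fun n x => max (|D n x| - ε * F n x ^ 2) 0)
      (fun x => (C ^ 2 / ε + |C|) * f x ^ 2)
      (fun n => ((hD n).norm.sub (((hF n).const_mul ε).aestronglyMeasurable)).sup
        aestronglyMeasurable_const) (hf.const_mul _) (fun n => ?_) ?_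
    · simpa using this
    · filter_upwards [hle' ε hε n] with x hx
      rw [Real.norm_of_nonneg (le_max_right _ _)]
      exact max_le (by linarith) (by positivity)
    · filter_upwards [hD0] with x hx
      have h0 : Tendsto (fun n => |D n x|) atTop (𝓝 0) := by simpa using hx.abs
      refine squeeze_zero (fun n => le_max_right _ _) (fun n => ?_) h0
      exact max_le (by have : 0 ≤ ε * F n x ^ 2 := by positivity
                       linarith) (abs_nonneg _)
  obtain ⟨n₀, hn₀⟩ := (Metric.tendsto_atTop.1 hW) (δ / 2) (by positivity)
  refine ⟨n₀, fun n hn => ?_⟩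
  have h1 := hn₀ n hn
  rw [Real.dist_eq, sub_zero] at h1 ⊢
  have hWi : Integrable (fun x => max (|D n x| - ε * F n x ^ 2) 0) μ :=
    ((hDi n).abs.sub ((hF n).const_mul ε)).pos_part
  calc |∫ x, D n x ∂μ| ≤ ∫ x, |D n x| ∂μ := abs_integral_le_integral_abs
    _ ≤ ∫ x, (max (|D n x| - ε * F n x ^ 2) 0 + ε * F n x ^ 2) ∂μ := by
        refine integral_mono (hDi n).abs (hWi.add ((hF n).const_mul ε)) fun x => ?_
        have := le_max_left (|D n x| - ε * F n x ^ 2) 0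
        simp only; linarith
    _ = (∫ x, max (|D n x| - ε * F n x ^ 2) 0 ∂μ) + ε * ∫ x, F n x ^ 2 ∂μ := by
        rw [integral_add hWi ((hF n).const_mul ε), integral_const_mul]
    _ ≤ |∫ x, max (|D n x| - ε * F n x ^ 2) 0 ∂μ| + ε * A :=
        add_le_add (le_abs_self _) (mul_le_mul_of_nonneg_left (hFA n) hε.le)
    _ < δ := by linarith

/-- The Brezis–Lieb lemma for uniformly bounded sequences that are bounded in `L²`. -/
theorem tendsto_integral_rpow_sub {r M A : ℝ} (hr : 2 ≤ r) {F : ℕ → ℝ → 𝕜} {f : ℝ → 𝕜}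
    (hF : ∀ n, MemLp (F n) 2 μ) (hf : MemLp f 2 μ)
    (hlim : ∀ᵐ x ∂μ, Tendsto (fun n => F n x) atTop (𝓝 (f x)))
    (hFM : ∀ n, ∀ᵐ x ∂μ, ‖F n x‖ ≤ M) (hfM : ∀ᵐ x ∂μ, ‖f x‖ ≤ M)
    (hA : ∀ n, ∫ x, ‖F n x‖ ^ 2 ∂μ ≤ A) :
    Tendsto (fun n => (∫ x, ‖F n x‖ ^ r ∂μ) - ∫ x, ‖F n x - f x‖ ^ r ∂μ) atTop
      (𝓝 (∫ x, ‖f x‖ ^ r ∂μ)) := by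
  have hr0 : 0 < r := by linarith
  have i1 := fun n => integrable_rpow_norm_of_bound hr (hF n) (hFM n)
  have i2 := integrable_rpow_norm_of_bound hr hf hfM
  have hsubM : ∀ n, ∀ᵐ x ∂μ, ‖(F n - f) x‖ ≤ 2 * M := fun n => by
    filter_upwards [hFM n, hfM] with x h1 h2
    exact (norm_sub_le _ _).trans (by linarith)
  have i3 := fun n => integrable_rpow_norm_of_bound hr ((hF n).sub hf) (hsubM n)
  simp only [Pi.sub_apply] at i3
  set C := r / 2 * ((2 * M) ^ 2) ^ (r / 2 - 1) with hC
  have hC0 : 0 ≤ C := by positivity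
  -- The first entry absorbs the cross term of `(2‖F n‖ + ‖f‖)‖f‖`; the second absorbs its square
  -- term together with `‖f‖ ^ r`.
  set E := max (2 * C) (C + M ^ (r - 2))
  have main := tendsto_integral_of_le_mul (μ := μ) (A := A) (C := E)
    (D := fun n x => ‖F n x‖ ^ r - ‖F n x - f x‖ ^ r - ‖f x‖ ^ r)
    (F := fun n x => ‖F n x‖) (f := fun x => ‖f x‖)
    (fun n => (((i1 n).sub (i3 n)).sub i2).aestronglyMeasurable) ?_
    (fun n => integrable_sq_of_memLp (hF n)) hA (integrable_sq_of_memLp hf) (fun n => ?_)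
  · have h2 := main.add_const (∫ x, ‖f x‖ ^ r ∂μ)
    rw [zero_add] at h2
    refine h2.congr fun n => ?_
    rw [integral_sub (f := fun x => ‖F n x‖ ^ r - ‖F n x - f x‖ ^ r) ((i1 n).sub (i3 n)) i2,
      integral_sub (i1 n) (i3 n)]
    ring
  · filter_upwards [hlim] with x hx
    have h1 : Tendsto (fun n => ‖F n x‖ ^ r) atTop (𝓝 (‖f x‖ ^ r)) :=
      hx.norm.rpow_const (Or.inr hr0.le)
    have h2 : Tendsto (fun n => ‖F n x - f x‖ ^ r) atTop (𝓝 0) := by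
      have h3 : Tendsto (fun n => F n x - f x) atTop (𝓝 0) := by
        simpa using hx.sub_const (f x)
      simpa [Real.zero_rpow hr0.ne'] using h3.norm.rpow_const (p := r) (Or.inr hr0.le)
    simpa using (h1.sub h2).sub_const (‖f x‖ ^ r)
  · filter_upwards [hFM n, hfM, hsubM n] with x h1 h2 h3
    simp only [Pi.sub_apply] at h3
    have hM : 0 ≤ M := (norm_nonneg _).trans h1
    have e1 := abs_rpow_sub_rpow_le hr (norm_nonneg (F n x))
      (by linarith) (norm_nonneg (F n x - f x)) h3
    have e2 := rpow_le_mul_sq hr (norm_nonneg (f x)) h2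
    have e3 : |‖F n x‖ - ‖F n x - f x‖| ≤ ‖f x‖ := by
      simpa using abs_norm_sub_norm_le (F n x) (F n x - f x)
    have e4 : ‖F n x - f x‖ ≤ ‖F n x‖ + ‖f x‖ := norm_sub_le _ _
    have e5 : C * ((‖F n x‖ + ‖F n x - f x‖) * |‖F n x‖ - ‖F n x - f x‖|)
        ≤ C * ((2 * ‖F n x‖ + ‖f x‖) * ‖f x‖) := by
      exact mul_le_mul_of_nonneg_left
        (mul_le_mul (by linarith) e3 (abs_nonneg _) (by positivity)) hC0
    have e6 : |‖F n x‖ ^ r - ‖F n x - f x‖ ^ r - ‖f x‖ ^ r|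
        ≤ |‖F n x‖ ^ r - ‖F n x - f x‖ ^ r| + ‖f x‖ ^ r := by
      refine (abs_sub _ _).trans (le_of_eq ?_)
      rw [abs_of_nonneg (Real.rpow_nonneg (norm_nonneg (f x)) r)]
    have e7 : 2 * C * (‖F n x‖ * ‖f x‖) ≤ E * (‖F n x‖ * ‖f x‖) := by
      gcongr; exact le_max_left _ _
    have e8 : (C + M ^ (r - 2)) * ‖f x‖ ^ 2 ≤ E * ‖f x‖ ^ 2 := by
      gcongr; exact le_max_right _ _
    rw [← hC] at e1
    linarith

/-- Weak convergence in `L²(μ)`. -/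
def WeakL2Tendsto (μ : Measure ℝ) (G : ℕ → ℝ → 𝕜) (g : ℝ → 𝕜) : Prop :=
  ∀ φ : ℝ → 𝕜, MemLp φ 2 μ →
    Tendsto (fun n => ∫ x, inner 𝕜 (φ x) (G n x) ∂μ) atTop (𝓝 (∫ x, inner 𝕜 (φ x) (g x) ∂μ))

/-- Sequential Banach–Alaoglu in the dual, carried back by the Riesz isomorphism. The conjugation in
the proof exchanges the two slots of the inner product. -/
theorem exists_subseq_tendsto_inner {H : Type*} [NormedAddCommGroup H] [InnerProductSpace 𝕜 H]
    [CompleteSpace H] [TopologicalSpace.SeparableSpace H] {x : ℕ → H} {R : ℝ}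
    (hx : ∀ n, ‖x n‖ ≤ R) :
    ∃ y : H, ∃ k : ℕ → ℕ, StrictMono k ∧
      ∀ z, Tendsto (fun n => inner 𝕜 z (x (k n))) atTop (𝓝 (inner 𝕜 z y)) := by
  have hc := WeakDual.isSeqCompact_closedBall 𝕜 H 0 R
  obtain ⟨a, -, k, hk, hlim⟩ := hc (x := fun n =>
    StrongDual.toWeakDual (InnerProductSpace.toDual 𝕜 H (x n))) (fun n => by
      simpa using hx n)
  refine ⟨(InnerProductSpace.toDual 𝕜 H).symm (WeakDual.toStrongDual a), k, hk, fun z => ?_⟩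
  have h1 := ((WeakDual.eval_continuous z).tendsto a).comp hlim
  have h2 := ((RCLike.continuous_conj (K := 𝕜)).tendsto _).comp h1
  convert h2 using 2
  · simp [Function.comp_def]
  · rw [← inner_conj_symm]
    congr 1
    simp

theorem exists_subseq_weakL2Tendsto [SFinite μ] {G : ℕ → ℝ → 𝕜} {A : ℝ}
    (hG : ∀ n, MemLp (G n) 2 μ) (hA : ∀ n, ∫ x, ‖G n x‖ ^ 2 ∂μ ≤ A) :
    ∃ g : ℝ → 𝕜, MemLp g 2 μ ∧ ∃ k : ℕ → ℕ, StrictMono k ∧ WeakL2Tendsto μ (fun n => G (k n)) g := by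
  have hin : ∀ {f g : ℝ → 𝕜} (hf : MemLp f 2 μ) (hg : MemLp g 2 μ),
      inner 𝕜 (hf.toLp f) (hg.toLp g) = ∫ x, inner 𝕜 (f x) (g x) ∂μ := by
    intro f g hf hg
    rw [L2.inner_def]
    refine integral_congr_ae ?_
    filter_upwards [hf.coeFn_toLp, hg.coeFn_toLp] with x h1 h2
    rw [h1, h2]
  have : Fact ((2 : ENNReal) ≠ ⊤) := ⟨ENNReal.ofNat_ne_top⟩
  obtain ⟨y, k, hk, hlim⟩ := exists_subseq_tendsto_inner (𝕜 := 𝕜)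
    (x := fun n => (hG n).toLp (G n)) (R := √A) (fun n => by
      refine Real.le_sqrt_of_sq_le ?_
      refine le_trans (le_of_eq ?_) (hA n)
      rw [← inner_self_eq_norm_sq (𝕜 := 𝕜), hin, ← integral_re]
      · simp
      · refine (integrable_sq_of_memLp (hG n)).ofReal.congr (ae_of_all _ fun x => ?_)
        simp)
  refine ⟨y, Lp.memLp y, k, hk, fun φ hφ => ?_⟩
  have h1 := hlim (hφ.toLp φ)
  simp_rw [hin] at h1
  convert h1 using 2
  rw [← hin hφ (Lp.memLp y), Lp.toLp_coeFn]

theorem WeakL2Tendsto.comp {G : ℕ → ℝ → 𝕜} {g : ℝ → 𝕜} (h : WeakL2Tendsto μ G g) {k : ℕ → ℕ}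
    (hk : StrictMono k) : WeakL2Tendsto μ (fun n => G (k n)) g :=
  fun φ hφ => (h φ hφ).comp hk.tendsto_atTop

/-- Expanding the square, the difference equals `2 Re ⟨g, G n⟩ - ‖g‖²`, which is affine in `G n` and
so passes to the weak limit. -/
theorem WeakL2Tendsto.tendsto_integral_sq_sub {G : ℕ → ℝ → 𝕜} {g : ℝ → 𝕜}
    (h : WeakL2Tendsto μ G g) (hG : ∀ n, MemLp (G n) 2 μ) (hg : MemLp g 2 μ) :
    Tendsto (fun n => (∫ x, ‖G n x‖ ^ 2 ∂μ) - ∫ x, ‖G n x - g x‖ ^ 2 ∂μ) atTop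
      (𝓝 (∫ x, ‖g x‖ ^ 2 ∂μ)) := by
  have h1 : Tendsto (fun n => 2 * RCLike.re (∫ x, inner 𝕜 (g x) (G n x) ∂μ) - ∫ x, ‖g x‖ ^ 2 ∂μ)
      atTop (𝓝 (2 * RCLike.re (∫ x, inner 𝕜 (g x) (g x) ∂μ) - ∫ x, ‖g x‖ ^ 2 ∂μ)) :=
    (((RCLike.continuous_re.tendsto _).comp (h g hg)).const_mul 2).sub_const _
  have hii : ∀ n, Integrable (fun x => inner 𝕜 (g x) (G n x)) μ := fun n => by
    exact (L2.integrable_inner (𝕜 := 𝕜) (hg.toLp g) ((hG n).toLp (G n))).congr (by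
      filter_upwards [hg.coeFn_toLp, (hG n).coeFn_toLp] with x h1 h2
      rw [h1, h2])
  have hgg : RCLike.re (∫ x, inner 𝕜 (g x) (g x) ∂μ) = ∫ x, ‖g x‖ ^ 2 ∂μ := by
    rw [← integral_re]
    · simp
    · refine (integrable_sq_of_memLp hg).ofReal.congr (ae_of_all _ fun x => ?_)
      simp
  rw [hgg] at h1
  convert h1 using 2 with n
  · rw [← integral_re (hii n), ← integral_const_mul,
      ← integral_sub (integrable_sq_of_memLp (hG n)) (show Integrable (fun x => ‖G n x - g x‖ ^ 2) μ
        from integrable_sq_of_memLp ((hG n).sub hg)),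
      ← integral_sub ((hii n).re.const_mul 2) (integrable_sq_of_memLp hg)]
    congr 1; ext x
    rw [norm_sub_sq (𝕜 := 𝕜), ← inner_conj_symm (G n x) (g x), RCLike.conj_re]
    ring
  · ring

/-- The indicator of `(0, x]` is an admissible test function, so weak convergence of derivatives
gives pointwise convergence of primitives. -/
theorem WeakL2Tendsto.tendsto_primitive {G : ℕ → ℝ → 𝕜} {g : ℝ → 𝕜}
    (h : WeakL2Tendsto (volume.restrict (Ioi 0)) G g) {x : ℝ} (hx : 0 ≤ x) :
    Tendsto (fun n => ∫ y in (0 : ℝ)..x, G n y) atTop (𝓝 (∫ y in (0 : ℝ)..x, g y)) := by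
  have hsub : Ioc 0 x ⊆ Ioi 0 := fun y hy => hy.1
  have h1 := h ((Ioc 0 x).indicator fun _ => 1) (by
    refine memLp_indicator_const 2 measurableSet_Ioc 1 (Or.inr ?_)
    rw [Measure.restrict_apply measurableSet_Ioc]
    exact ((measure_mono inter_subset_left).trans_lt (by simp)).ne)
  have key : ∀ f : ℝ → 𝕜, ∫ y in Ioi 0, inner 𝕜 ((Ioc 0 x).indicator (fun _ => 1) y) (f y)
      = ∫ y in (0 : ℝ)..x, f y := by
    intro f
    rw [intervalIntegral.integral_of_le hx, ← integral_indicator measurableSet_Ioi,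
      ← integral_indicator measurableSet_Ioc]
    congr 1; ext y
    by_cases hy : y ∈ Ioc 0 x
    · simp [hy, hsub hy]
    · simp [hy, indicator]
  simpa only [key] using h1

/-- Fatou's lemma for the `L²` norm. -/
theorem memLp_two_of_tendsto {F : ℕ → ℝ → 𝕜} {f : ℝ → 𝕜} {A : ℝ} (hF : ∀ n, MemLp (F n) 2 μ)
    (hA : ∀ n, ∫ x, ‖F n x‖ ^ 2 ∂μ ≤ A)
    (hlim : ∀ᵐ x ∂μ, Tendsto (fun n => F n x) atTop (𝓝 (f x))) : MemLp f 2 μ := by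
  have hm : AEStronglyMeasurable f μ :=
    aestronglyMeasurable_of_tendsto_ae atTop (fun n => (hF n).aestronglyMeasurable) hlim
  refine ⟨hm, lt_of_le_of_lt (Lp.eLpNorm_lim_le_liminf_eLpNorm
    (fun n => (hF n).aestronglyMeasurable) f hlim) ?_⟩
  refine lt_of_le_of_lt (liminf_le_of_le (a := ENNReal.ofReal (√A)) (by isBoundedDefault) ?_)
    ENNReal.ofReal_lt_top
  intro b hb
  obtain ⟨n, hn⟩ := hb.exists
  refine hn.trans ?_
  rw [(hF n).eLpNorm_eq_integral_rpow_norm two_ne_zero ENNReal.ofNat_ne_top]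
  apply ENNReal.ofReal_le_ofReal
  rw [Real.sqrt_eq_rpow]
  simp only [ENNReal.toReal_ofNat, Real.rpow_ofNat, one_div]
  gcongr
  exact hA n

/-- Subsequences are refined successively over the finite index set; this yields one subsequence
serving all half-lines. -/
theorem exists_common_subseq {ι : Type*} [Finite ι] (P : ι → (ℕ → ℕ) → Prop)
    (hex : ∀ i (k : ℕ → ℕ), StrictMono k → ∃ j : ℕ → ℕ, StrictMono j ∧ P i (k ∘ j))
    (hsub : ∀ i (k j : ℕ → ℕ), P i k → StrictMono j → P i (k ∘ j)) :
    ∃ k : ℕ → ℕ, StrictMono k ∧ ∀ i, P i k := by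
  classical
  have := Fintype.ofFinite ι
  suffices h : ∀ s : Finset ι, ∃ k : ℕ → ℕ, StrictMono k ∧ ∀ i ∈ s, P i k by
    obtain ⟨k, hk, h⟩ := h Finset.univ
    exact ⟨k, hk, fun i => h i (Finset.mem_univ i)⟩
  intro s
  induction s using Finset.induction_on with
  | empty => exact ⟨id, strictMono_id, by simp⟩
  | insert i s _ ih =>
    obtain ⟨k, hk, h⟩ := ih
    obtain ⟨j, hj, hP⟩ := hex i k hk
    refine ⟨k ∘ j, hk.comp hj, fun l hl => ?_⟩
    rcases Finset.mem_insert.1 hl with rfl | hl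
    · exact hP
    · exact hsub l k j (h l hl) hj

end StarNLS

/-! ### Functions on the star graph and coercivity of the energy -/

namespace StarNLS

theorem exists_mul_rpow_le {s ε : ℝ} (hs : 0 ≤ s) (hs1 : s < 1) (hε : 0 < ε) (a : ℝ) :
    ∃ C, ∀ x, 0 ≤ x → a * x ^ s ≤ ε * x + C := by
  have h : Tendsto (fun x : ℝ => |a| * x ^ (-(1 - s))) atTop (𝓝 (|a| * 0)) :=
    (tendsto_rpow_neg_atTop (by linarith)).const_mul _
  rw [mul_zero] at h
  obtain ⟨X, hX⟩ := (h.eventually (ge_mem_nhds hε)).exists_forall_of_atTop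
  have hC : 0 ≤ |a| * (max X 1) ^ s := by positivity
  refine ⟨|a| * (max X 1) ^ s, fun x hx => ?_⟩
  have h1 : a * x ^ s ≤ |a| * x ^ s := by gcongr; exact le_abs_self a
  rcases le_total x (max X 1) with hxX | hxX
  · have h2 : |a| * x ^ s ≤ |a| * (max X 1) ^ s := by gcongr
    have : 0 ≤ ε * x := by positivity
    linarith
  · have hx0 : 0 < x := lt_of_lt_of_le (by positivity) hxX
    have h2 := hX x ((le_max_left _ _).trans hxX)
    have h3 : x ^ s = x ^ (-(1 - s)) * x := by
      rw [← Real.rpow_add_one hx0.ne']; congr 1; ring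
    rw [h3, ← mul_assoc] at h1
    have h4 : |a| * x ^ (-(1 - s)) * x ≤ ε * x := by gcongr
    rw [h3, ← mul_assoc]
    linarith

/-- `u` is an `H¹` function on the star graph with derivative `g`. -/
structure IsStarPair {𝕜 : Type*} [RCLike 𝕜] {N : ℕ} (u g : Fin N → ℝ → 𝕜) : Prop where
  pair : ∀ i, IsH1Pair (Ioi 0) (u i) (g i)
  vertex : ∀ i j, u i 0 = u j 0

/-- `‖u‖_{L^p(S_N)}^p`. -/
noncomputable def starPotential {𝕜 : Type*} [RCLike 𝕜] {N : ℕ} (p : ℝ) (u : Fin N → ℝ → 𝕜) : ℝ :=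
  ∑ i, ∫ x in Ioi 0, ‖u i x‖ ^ p

variable {𝕜 : Type*} [RCLike 𝕜] {N : ℕ} {u g : Fin N → ℝ → 𝕜}

theorem starEnergy_eq [NeZero N] (p q : ℝ) (u : Fin N → ℝ → 𝕜) :
    starEnergy p q u = 1 / 2 * starKinetic u - 1 / p * starPotential p u - 1 / q * ‖u 0 0‖ ^ q :=
  rfl

theorem IsStarPair.memH1Star (h : IsStarPair u g) : MemH1Star u :=
  ⟨fun i => (h.pair i).memH1 isBasedInterval_Ioi,
    fun i => by simpa using (h.pair i).continuousOn isBasedInterval_Ioi, h.vertex⟩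

theorem MemH1Star.isStarPair (h : MemH1Star u) : IsStarPair u (fun i => weakDeriv (Ioi 0) (u i)) :=
  ⟨fun i => (h.memH1 i).isH1Pair (h.continuousOn i), h.vertex⟩

theorem IsStarPair.starKinetic_eq (h : IsStarPair u g) :
    starKinetic u = ∑ i, ∫ x in Ioi 0, ‖g i x‖ ^ 2 := by
  refine Finset.sum_congr rfl fun i _ => integral_congr_ae ?_
  filter_upwards [(h.pair i).weakDeriv_ae_eq isBasedInterval_Ioi] with x hx
  rw [hx]

theorem IsStarPair.sub {u' g' : Fin N → ℝ → 𝕜} (h : IsStarPair u g) (h' : IsStarPair u' g') :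
    IsStarPair (u - u') (g - g') :=
  ⟨fun i => (h.pair i).sub isBasedInterval_Ioi (h'.pair i), fun i j => by
    simp [h.vertex i j, h'.vertex i j]⟩

theorem IsStarPair.smul (h : IsStarPair u g) (c : ℝ) : IsStarPair (c • u) (c • g) :=
  ⟨fun i => (h.pair i).smul c, fun i j => by simp [h.vertex i j]⟩

theorem MemH1Star.sub {u' : Fin N → ℝ → 𝕜} (h : MemH1Star u) (h' : MemH1Star u') :
    MemH1Star (u - u') :=
  (h.isStarPair.sub h'.isStarPair).memH1Star

theorem MemH1Star.smul (h : MemH1Star u) (c : ℝ) : MemH1Star (c • u) :=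
  (h.isStarPair.smul c).memH1Star

theorem starMass_nonneg (u : Fin N → ℝ → 𝕜) : 0 ≤ starMass u :=
  Finset.sum_nonneg fun _ _ => integral_nonneg fun _ => by positivity

theorem starKinetic_nonneg (u : Fin N → ℝ → 𝕜) : 0 ≤ starKinetic u :=
  Finset.sum_nonneg fun _ _ => integral_nonneg fun _ => by positivity

theorem starPotential_nonneg (p : ℝ) (u : Fin N → ℝ → 𝕜) : 0 ≤ starPotential p u :=
  Finset.sum_nonneg fun _ _ => integral_nonneg fun _ => by positivity

theorem starMass_smul (c : ℝ) (u : Fin N → ℝ → 𝕜) : starMass (c • u) = c ^ 2 * starMass u := by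
  simp [starMass, norm_smul, mul_pow, integral_const_mul, Finset.mul_sum]

theorem MemH1Star.starKinetic_smul (h : MemH1Star u) (c : ℝ) :
    starKinetic (c • u) = c ^ 2 * starKinetic u := by
  rw [(h.isStarPair.smul c).starKinetic_eq, h.isStarPair.starKinetic_eq]
  simp [norm_smul, mul_pow, integral_const_mul, Finset.mul_sum]

theorem starPotential_smul {c : ℝ} (hc : 0 ≤ c) (p : ℝ) (u : Fin N → ℝ → 𝕜) :
    starPotential p (c • u) = c ^ p * starPotential p u := by
  simp only [starPotential, Finset.mul_sum, Pi.smul_apply, norm_smul, Real.norm_eq_abs,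
    abs_of_nonneg hc, ← integral_const_mul, Real.mul_rpow hc (norm_nonneg _)]

theorem MemH1Star.starEnergy_smul [NeZero N] (h : MemH1Star u) {c : ℝ} (hc : 0 ≤ c) (p q : ℝ) :
    starEnergy p q (c • u) = c ^ 2 * (1 / 2 * starKinetic u) - c ^ p * (1 / p * starPotential p u)
      - c ^ q * (1 / q * ‖u 0 0‖ ^ q) := by
  rw [starEnergy_eq, h.starKinetic_smul, starPotential_smul hc]
  simp only [Pi.smul_apply, norm_smul, Real.norm_eq_abs, abs_of_nonneg hc]
  rw [Real.mul_rpow hc (norm_nonneg _)]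
  ring

theorem integral_le_starMass (u : Fin N → ℝ → 𝕜) (i : Fin N) :
    ∫ x in Ioi 0, ‖u i x‖ ^ 2 ≤ starMass u :=
  Finset.single_le_sum (f := fun i => ∫ x in Ioi 0, ‖u i x‖ ^ 2)
    (fun _ _ => integral_nonneg fun _ => by positivity) (Finset.mem_univ i)

theorem IsStarPair.integral_le_starKinetic (h : IsStarPair u g) (i : Fin N) :
    ∫ x in Ioi 0, ‖g i x‖ ^ 2 ≤ starKinetic u := by
  rw [h.starKinetic_eq]
  exact Finset.single_le_sum (f := fun i => ∫ x in Ioi 0, ‖g i x‖ ^ 2)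
    (fun _ _ => integral_nonneg fun _ => by positivity) (Finset.mem_univ i)

/-- The length `d` stays free: it is later balanced against the kinetic energy, fixed at `1`, or
sent to zero. -/
theorem MemH1Star.sq_norm_le (h : MemH1Star u) {x d : ℝ} (hd : 0 < d) (hx : 0 ≤ x) (i : Fin N) :
    ‖u i x‖ ^ 2 ≤ 2 / d * starMass u + 2 * d * starKinetic u := by
  refine ((h.isStarPair.pair i).sq_norm_le hd hx).trans ?_
  gcongr
  · exact integral_le_starMass u i
  · exact h.isStarPair.integral_le_starKinetic i

theorem MemH1Star.norm_le (h : MemH1Star u) {A B : ℝ} (hA : starMass u ≤ A)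
    (hB : starKinetic u ≤ B) {x : ℝ} (hx : 0 ≤ x) (i : Fin N) : ‖u i x‖ ≤ √(2 * A + 2 * B) := by
  refine Real.le_sqrt_of_sq_le ((h.sq_norm_le one_pos hx i).trans ?_)
  linarith

theorem MemH1Star.starPotential_le (h : MemH1Star u) {p M : ℝ} (hp : 2 ≤ p)
    (hM : ∀ i x, 0 ≤ x → ‖u i x‖ ≤ M) : starPotential p u ≤ M ^ (p - 2) * starMass u := by
  rw [starPotential, starMass, Finset.mul_sum]
  refine Finset.sum_le_sum fun i _ => integral_rpow_norm_le hp (h.memH1 i).1 ?_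
  exact ae_restrict_of_forall_mem measurableSet_Ioi fun x hx => hM i x (le_of_lt hx)

/-- The energy controls the kinetic part at fixed mass. -/
theorem exists_starKinetic_le_starEnergy (𝕜 : Type*) [RCLike 𝕜] (N : ℕ) [NeZero N] {p q : ℝ}
    (hp2 : 2 < p) (hp6 : p < 6) (hq2 : 2 < q) (hq4 : q < 4) {m : ℝ} (hm : 0 < m) :
    ∃ B, ∀ u : Fin N → ℝ → 𝕜, MemH1Star u → starMass u = m →
      1 / 4 * starKinetic u - B ≤ starEnergy p q u := by
  -- Sublinearity of the powers `(p - 2) / 4` and `q / 4` is exactly `p < 6` and `q < 4`. Two terms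
  -- with weight `1 / 8` use up half of the coefficient `1 / 2` of the kinetic energy.
  obtain ⟨C₁, hC₁⟩ := exists_mul_rpow_le (s := (p - 2) / 4) (ε := 1 / 8) (by linarith)
    (by linarith) (by norm_num) (1 / p * (m * (2 * (m + 1)) ^ ((p - 2) / 2)))
  obtain ⟨C₂, hC₂⟩ := exists_mul_rpow_le (s := q / 4) (ε := 1 / 8) (by linarith)
    (by linarith) (by norm_num) (1 / q * (2 * (m + 1)) ^ (q / 2))
  refine ⟨C₁ + C₂ + 1 / 4, fun u hu hmass => ?_⟩
  set K := starKinetic u with hK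
  have hK0 : 0 ≤ K := starKinetic_nonneg u
  set S := 2 * (m + 1) * √(K + 1) with hS
  have hS0 : 0 ≤ S := by positivity
  have hsq : √(K + 1) * √(K + 1) = K + 1 := Real.mul_self_sqrt (by linarith)
  have hsq1 : 0 < √(K + 1) := by positivity
  have hpt : ∀ i x, 0 ≤ x → ‖u i x‖ ≤ √S := by
    intro i x hx
    -- This `d` balances the two Sobolev terms, so the squared supremum grows only like the square
    -- root of the kinetic energy.
    refine Real.le_sqrt_of_sq_le ((hu.sq_norm_le (d := (√(K + 1))⁻¹) (by positivity) hx i).trans ?_)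
    rw [hmass, ← hK, hS]
    have : (√(K + 1))⁻¹ * K ≤ √(K + 1) := by
      rw [inv_mul_le_iff₀ hsq1]; linarith
    rw [div_inv_eq_mul]
    nlinarith
  have hSr : ∀ r : ℝ, √S ^ r = (2 * (m + 1)) ^ (r / 2) * (K + 1) ^ (r / 4) := by
    intro r
    rw [Real.sqrt_eq_rpow, ← Real.rpow_mul hS0, hS, Real.mul_rpow (by positivity) (by positivity),
      Real.sqrt_eq_rpow, ← Real.rpow_mul (by positivity)]
    congr 2 <;> ring
  have h1 := hu.starPotential_le hp2.le hpt
  have h2 : ‖u 0 0‖ ^ q ≤ √S ^ q := by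
    gcongr
    exact hpt 0 0 le_rfl
  rw [hmass, hSr] at h1
  rw [hSr] at h2
  have h3 := hC₁ (K + 1) (by linarith)
  have h4 := hC₂ (K + 1) (by linarith)
  have h5 : 1 / p * starPotential p u
      ≤ 1 / p * ((2 * (m + 1)) ^ ((p - 2) / 2) * (K + 1) ^ ((p - 2) / 4) * m) := by gcongr
  have h6 : 1 / q * ‖u 0 0‖ ^ q ≤ 1 / q * ((2 * (m + 1)) ^ (q / 2) * (K + 1) ^ (q / 4)) := by
    gcongr
  rw [starEnergy_eq, ← hK]
  linarith

end StarNLS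

/-! ### Exponential tails -/

namespace StarNLS

section exponentials

variable {𝕜 : Type*} [RCLike 𝕜]

theorem norm_exp_smul_rpow (t r : ℝ) (a : 𝕜) :
    ‖Real.exp t • a‖ ^ r = Real.exp (r * t) * ‖a‖ ^ r := by
  rw [norm_smul, Real.norm_of_nonneg (Real.exp_pos _).le,
    Real.mul_rpow (Real.exp_pos _).le (norm_nonneg _), ← Real.exp_mul, mul_comm t r]

theorem integral_Ioi_norm_exp_neg_smul_rpow {r : ℝ} (hr : 0 < r) (a : 𝕜) :
    ∫ x in Ioi (0 : ℝ), ‖Real.exp (-x) • a‖ ^ r = ‖a‖ ^ r / r := by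
  simp_rw [norm_exp_smul_rpow, mul_neg, ← neg_mul]
  rw [integral_mul_const, integral_exp_mul_Ioi (by linarith)]
  simp
  ring

theorem integral_Iic_norm_exp_smul_rpow {r : ℝ} (hr : 0 < r) (a : 𝕜) :
    ∫ x in Iic (0 : ℝ), ‖Real.exp x • a‖ ^ r = ‖a‖ ^ r / r := by
  simp_rw [norm_exp_smul_rpow]
  rw [integral_mul_const, integral_exp_mul_Iic hr]
  simp
  ring

theorem integral_Ioi_norm_exp_neg_smul_sq (a : 𝕜) :
    ∫ x in Ioi (0 : ℝ), ‖Real.exp (-x) • a‖ ^ 2 = ‖a‖ ^ 2 / 2 := by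
  simpa using integral_Ioi_norm_exp_neg_smul_rpow two_pos a

theorem integrableOn_Iic_norm_exp_smul_rpow {r : ℝ} (hr : 0 < r) (a : 𝕜) :
    IntegrableOn (fun x => ‖Real.exp x • a‖ ^ r) (Iic 0) := by
  simp_rw [norm_exp_smul_rpow]
  exact (integrableOn_exp_mul_Iic hr 0).mul_const _

theorem memLp_exp_neg_smul (a : 𝕜) :
    MemLp (fun x => Real.exp (-x) • a) 2 (volume.restrict (Ioi 0)) := by
  rw [memLp_two_iff_integrable_sq_norm (by fun_prop)]
  simp_rw [← Real.rpow_two, norm_exp_smul_rpow, mul_neg, ← neg_mul]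
  exact (integrableOn_exp_mul_Ioi (by norm_num) 0).mul_const _

theorem memLp_exp_smul (a : 𝕜) :
    MemLp (fun x => Real.exp x • a) 2 (volume.restrict (Iic 0)) := by
  rw [memLp_two_iff_integrable_sq_norm (by fun_prop)]
  simpa [IntegrableOn] using integrableOn_Iic_norm_exp_smul_rpow two_pos a

theorem isH1Pair_exp_neg_smul (a : 𝕜) :
    IsH1Pair (Ioi 0) (fun x => Real.exp (-x) • a) (fun x => -(Real.exp (-x) • a)) := by
  refine ⟨memLp_exp_neg_smul a, (memLp_exp_neg_smul a).neg, fun x _ => ?_⟩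
  have hd : ∀ y : ℝ, HasDerivAt (fun x => Real.exp (-x) • a) (-(Real.exp (-y) • a)) y := fun y => by
    have h1 : HasDerivAt (fun x : ℝ => Real.exp (-x)) (-Real.exp (-y)) y := by
      simpa using (hasDerivAt_neg y).exp
    simpa using h1.smul_const a
  rw [intervalIntegral.integral_eq_sub_of_hasDerivAt (fun y _ => hd y)
    (Continuous.intervalIntegrable (by fun_prop) _ _)]
  ring

/-- Extension of a function on the half-line to the line by an exponential tail. -/
theorem IsH1Pair.glue_exp {u g : ℝ → 𝕜} (h : IsH1Pair (Ioi 0) u g) :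
    IsH1Pair univ ((Ioi 0).piecewise u fun x => Real.exp x • u 0)
      ((Ioi 0).piecewise g fun x => Real.exp x • u 0) := by
  have hexp : MemLp (fun x => Real.exp x • u 0) 2 (volume.restrict (Ioi 0)ᶜ) := by
    rw [compl_Ioi]; exact memLp_exp_smul _
  refine ⟨?_, ?_, fun x _ => ?_⟩
  · rw [Measure.restrict_univ]; exact h.memLp.piecewise measurableSet_Ioi hexp
  · rw [Measure.restrict_univ]; exact h.memLp_deriv.piecewise measurableSet_Ioi hexp
  · rw [piecewise_eq_of_notMem (Ioi (0:ℝ)) _ _ (by simp : (0:ℝ) ∉ Ioi 0)]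
    rcases lt_or_ge 0 x with hx | hx
    · rw [piecewise_eq_of_mem (Ioi (0:ℝ)) _ _ hx, h.ftc x (by simpa using hx.le)]
      simp only [Real.exp_zero, one_smul]
      congr 1
      rw [intervalIntegral.integral_of_le hx.le, intervalIntegral.integral_of_le hx.le]
      exact setIntegral_congr_fun measurableSet_Ioc fun y hy =>
        (piecewise_eq_of_mem (Ioi (0:ℝ)) g (fun x => Real.exp x • u 0) hy.1).symm
    · rw [piecewise_eq_of_notMem (Ioi (0:ℝ)) _ _ (by simpa using hx)]
      have hd : ∀ y : ℝ, HasDerivAt (fun x => Real.exp x • u 0) (Real.exp y • u 0) y := fun y =>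
        (Real.hasDerivAt_exp y).smul_const _
      have : ∫ y in (0:ℝ)..x, (Ioi 0).piecewise g (fun x => Real.exp x • u 0) y
          = ∫ y in (0:ℝ)..x, Real.exp y • u 0 := by
        refine intervalIntegral.integral_congr fun y hy => ?_
        rw [uIcc_of_ge hx] at hy
        exact piecewise_eq_of_notMem _ _ _ (by simpa using hy.2)
      rw [this, intervalIntegral.integral_eq_sub_of_hasDerivAt (fun y _ => hd y)
        (Continuous.intervalIntegrable (by fun_prop) _ _)]
      ring

theorem integral_norm_rpow_piecewise {r : ℝ} (hr : 0 < r) {f : ℝ → 𝕜} (a : 𝕜)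
    (hf : IntegrableOn (fun x => ‖f x‖ ^ r) (Ioi 0)) :
    ∫ x, ‖(Ioi (0:ℝ)).piecewise f (fun x => Real.exp x • a) x‖ ^ r
      = (∫ x in Ioi 0, ‖f x‖ ^ r) + ‖a‖ ^ r / r := by
  rw [← integral_Iic_norm_exp_smul_rpow hr, ← intervalIntegral.integral_Iic_add_Ioi (b := 0), add_comm]
  · congr 1
    · refine setIntegral_congr_fun measurableSet_Ioi fun x hx => ?_
      simp only [piecewise_eq_of_mem _ _ _ hx]
    · refine setIntegral_congr_fun measurableSet_Iic fun x hx => ?_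
      have : x ∉ Ioi (0:ℝ) := by simpa using hx
      simp only [piecewise_eq_of_notMem _ _ _ this]
  · refine (integrableOn_Iic_norm_exp_smul_rpow hr a).congr_fun (fun x hx => ?_) measurableSet_Iic
    have : x ∉ Ioi (0:ℝ) := by simpa using hx
    simp only [piecewise_eq_of_notMem _ _ _ this]
  · refine hf.congr_fun (fun x hx => ?_) measurableSet_Ioi
    simp only [piecewise_eq_of_mem _ _ _ hx]

theorem integral_norm_sq_piecewise {f : ℝ → 𝕜} (a : 𝕜)
    (hf : MemLp f 2 (volume.restrict (Ioi 0))) :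
    ∫ x, ‖(Ioi (0:ℝ)).piecewise f (fun x => Real.exp x • a) x‖ ^ 2
      = (∫ x in Ioi 0, ‖f x‖ ^ 2) + ‖a‖ ^ 2 / 2 := by
  have := integral_norm_rpow_piecewise two_pos a (f := f)
    (by simpa [IntegrableOn] using integrable_sq_of_memLp hf)
  simpa using this

end exponentials

/-! ### Functions on the line and their translates -/

section line

variable {𝕜 : Type*} [RCLike 𝕜] {v g : ℝ → 𝕜}

theorem IsH1Pair.lineEnergy_eq (h : IsH1Pair univ v g) (p : ℝ) :
    lineEnergy p v = 1 / 2 * (∫ x, ‖g x‖ ^ 2) - 1 / p * ∫ x, ‖v x‖ ^ p := by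
  have := h.weakDeriv_ae_eq isBasedInterval_univ
  rw [Measure.restrict_univ] at this
  rw [lineEnergy]
  congr 2
  refine integral_congr_ae ?_
  filter_upwards [this] with x hx
  rw [hx]

theorem MemH1.exists_lineEnergy_eq (h : MemH1 univ v) (p : ℝ) :
    ∃ w g : ℝ → 𝕜, IsH1Pair univ w g ∧ (∫ x, ‖w x‖ ^ 2) = (∫ x, ‖v x‖ ^ 2) ∧
      lineEnergy p w = lineEnergy p v := by
  obtain ⟨w, hw, hp⟩ := h.exists_isH1Pair isBasedInterval_univ
  rw [Measure.restrict_univ] at hw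
  refine ⟨w, _, hp, integral_congr_ae ?_, ?_⟩
  · filter_upwards [hw] with x hx
    rw [hx]
  · rw [hp.lineEnergy_eq, lineEnergy]
    congr 2
    refine integral_congr_ae ?_
    filter_upwards [hw] with x hx
    rw [hx]

theorem IsH1Pair.exists_norm_le_univ (h : IsH1Pair univ v g) : ∃ M, ∀ x, ‖v x‖ ≤ M := by
  have iu : Integrable fun y => ‖v y‖ ^ 2 := by
    simpa using integrable_sq_of_memLp h.memLp
  have ig : Integrable fun y => ‖g y‖ ^ 2 := by
    simpa using integrable_sq_of_memLp h.memLp_deriv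
  refine ⟨√(2 * (∫ y, ‖v y‖ ^ 2) + 2 * ∫ y, ‖g y‖ ^ 2), fun x => Real.le_sqrt_of_sq_le ?_⟩
  refine (h.sq_norm_le_of_Ioc isBasedInterval_univ one_pos (by simp) (subset_univ _)).trans ?_
  rw [div_one, mul_one]
  gcongr 2 * ?_ + 2 * ?_
  · exact setIntegral_le_integral iu (ae_of_all _ fun _ => by positivity)
  · exact setIntegral_le_integral ig (ae_of_all _ fun _ => by positivity)

theorem setIntegral_Ioi_comp_sub {E : Type*} [NormedAddCommGroup E] [NormedSpace ℝ E]
    (F : ℝ → E) (s : ℝ) : ∫ x in Ioi 0, F (x - s) = ∫ x in Ioi (-s), F x := by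
  have := (measurePreserving_sub_right (volume : Measure ℝ) s).setIntegral_preimage_emb
    (MeasurableEquiv.subRight s).measurableEmbedding F (Ioi (-s))
  rw [← this]
  congr 2
  ext x; simp

theorem tendsto_setIntegral_Ioi_neg {F : ℝ → ℝ} (hF : Integrable F) :
    Tendsto (fun n : ℕ => ∫ x in Ioi 0, F (x - n)) atTop (𝓝 (∫ x, F x)) := by
  have h1 : Tendsto (fun n : ℕ => -(n : ℝ)) atTop atBot :=
    tendsto_neg_atTop_atBot.comp tendsto_natCast_atTop_atTop
  have h2 := ((tendsto_setIntegral_Iic_atBot hF).comp h1).const_sub (∫ x, F x)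
  rw [sub_zero] at h2
  refine h2.congr fun n => ?_
  rw [setIntegral_Ioi_comp_sub, ← intervalIntegral.integral_Iic_add_Ioi (b := -(n : ℝ))
    hF.integrableOn hF.integrableOn]
  simp

theorem IsH1Pair.comp_sub (h : IsH1Pair univ v g) (s : ℝ) :
    IsH1Pair (Ioi 0) (fun x => v (x - s)) (fun x => g (x - s)) := by
  have hmp := measurePreserving_sub_right (volume : Measure ℝ) s
  have m1 := h.memLp
  have m2 := h.memLp_deriv
  rw [Measure.restrict_univ] at m1 m2
  refine ⟨(m1.comp_measurePreserving hmp).restrict _, (m2.comp_measurePreserving hmp).restrict _,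
    fun x _ => ?_⟩
  rw [intervalIntegral.integral_comp_sub_right, h.ftc (x - s) (by simp), h.ftc (0 - s) (by simp),
    ← intervalIntegral.integral_add_adjacent_intervals
      (isBasedInterval_univ.intervalIntegrable h.memLp_deriv (by simp : (0 - s) ∈ closure univ))
      ((isBasedInterval_univ.intervalIntegrable h.memLp_deriv (by simp)).symm.trans
      (isBasedInterval_univ.intervalIntegrable h.memLp_deriv (by simp)))]
  ring

end line

/-! ### The level on the star graph is at most that of the line -/

section level

variable {𝕜 : Type*} [RCLike 𝕜] {N : ℕ} [NeZero N]

theorem sum_ite_eq_zero_const (x y : ℝ) :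
    ∑ i : Fin N, (if i = 0 then x else y) = x + (N - 1) * y := by
  have h : ∀ i : Fin N, (if i = 0 then x else y) = (if i = 0 then x - y else 0) + y := fun i => by
    split_ifs <;> ring
  simp_rw [h]
  rw [Finset.sum_add_distrib, Finset.sum_ite_eq' Finset.univ (0 : Fin N)]
  simp
  ring

/-- A function on the line can be approximated in energy by functions on the star graph. -/
theorem exists_seq_tendsto_lineEnergy {p q m : ℝ} (hp : 2 < p) (hq : 2 < q) (hm : 0 < m)
    {v : ℝ → 𝕜} (hv : v ∈ H1MassLine 𝕜 m) :
    ∃ w : ℕ → Fin N → ℝ → 𝕜, (∀ᶠ n in atTop, w n ∈ H1MassStar 𝕜 N m) ∧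
      Tendsto (fun n => starEnergy p q (w n)) atTop (𝓝 (lineEnergy p v)) := by
  obtain ⟨v', g, hpair, hmass, hE⟩ := hv.1.exists_lineEnergy_eq p
  rw [hv.2] at hmass
  rw [← hE]
  clear hv hE
  obtain ⟨M, hM⟩ := hpair.exists_norm_le_univ
  have hp0 : 0 < p := by linarith
  have hq0 : 0 < q := by linarith
  have iu : Integrable fun y => ‖v' y‖ ^ 2 := by
    simpa using integrable_sq_of_memLp hpair.memLp
  have ig : Integrable fun y => ‖g y‖ ^ 2 := by
    simpa using integrable_sq_of_memLp hpair.memLp_deriv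
  have ip : Integrable fun y => ‖v' y‖ ^ p := by
    simpa using integrable_rpow_norm_of_bound hp.le hpair.memLp (ae_of_all _ hM)
  set a : ℕ → 𝕜 := fun n => v' (-n) with ha
  have ha0 : Tendsto (fun n => ‖a n‖) atTop (𝓝 0) := by
    have h1 : Tendsto (fun n : ℕ => -(n : ℝ)) atTop atBot :=
      tendsto_neg_atTop_atBot.comp tendsto_natCast_atTop_atTop
    simpa using (hpair.tendsto_atBot.comp h1).norm
  -- The profile moves out along the half-line `0`; the other half-lines carry exponentials that
  -- restore continuity at the vertex.
  let w : ℕ → Fin N → ℝ → 𝕜 := fun n i =>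
    if i = 0 then fun x => v' (x - n) else fun x => Real.exp (-x) • a n
  let w' : ℕ → Fin N → ℝ → 𝕜 := fun n i =>
    if i = 0 then fun x => g (x - n) else fun x => -(Real.exp (-x) • a n)
  have hw0 : ∀ n i, w n i 0 = a n := fun n i => by
    simp only [w, ha]; split_ifs <;> simp
  have hw : ∀ n, IsStarPair (w n) (w' n) := fun n =>
    ⟨fun i => by
      simp only [w, w']; split_ifs
      · exact hpair.comp_sub n
      · exact isH1Pair_exp_neg_smul _, fun i j => by rw [hw0, hw0]⟩
  have e1 : ∀ n, starMass (w n)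
      = (∫ x in Ioi 0, ‖v' (x - n)‖ ^ 2) + (N - 1) * (‖a n‖ ^ 2 / 2) := fun n => by
    rw [← sum_ite_eq_zero_const, starMass]
    refine Finset.sum_congr rfl fun i _ => ?_
    simp only [w]; split_ifs
    · rfl
    · rw [integral_Ioi_norm_exp_neg_smul_sq]
  have e2 : ∀ n, starKinetic (w n)
      = (∫ x in Ioi 0, ‖g (x - n)‖ ^ 2) + (N - 1) * (‖a n‖ ^ 2 / 2) := fun n => by
    rw [← sum_ite_eq_zero_const, (hw n).starKinetic_eq]
    refine Finset.sum_congr rfl fun i _ => ?_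
    simp only [w']; split_ifs
    · rfl
    · simp only [norm_neg]; rw [integral_Ioi_norm_exp_neg_smul_sq]
  have e3 : ∀ n, starPotential p (w n)
      = (∫ x in Ioi 0, ‖v' (x - n)‖ ^ p) + (N - 1) * (‖a n‖ ^ p / p) := fun n => by
    rw [← sum_ite_eq_zero_const, starPotential]
    refine Finset.sum_congr rfl fun i _ => ?_
    simp only [w]; split_ifs
    · rfl
    · rw [integral_Ioi_norm_exp_neg_smul_rpow hp0]
  have hsq0 : Tendsto (fun n => ((N : ℝ) - 1) * (‖a n‖ ^ 2 / 2)) atTop (𝓝 0) := by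
    simpa using ((ha0.pow 2).div_const 2).const_mul ((N : ℝ) - 1)
  have hp00 : Tendsto (fun n => ((N : ℝ) - 1) * (‖a n‖ ^ p / p)) atTop (𝓝 0) := by
    simpa [Real.zero_rpow hp0.ne'] using
      ((ha0.rpow_const (p := p) (Or.inr hp0.le)).div_const p).const_mul ((N : ℝ) - 1)
  have t1 : Tendsto (fun n => starMass (w n)) atTop (𝓝 m) := by
    simp_rw [e1]
    simpa [hmass] using (tendsto_setIntegral_Ioi_neg iu).add hsq0
  have t2 : Tendsto (fun n => starKinetic (w n)) atTop (𝓝 (∫ x, ‖g x‖ ^ 2)) := by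
    simp_rw [e2]
    simpa using (tendsto_setIntegral_Ioi_neg ig).add hsq0
  have t3 : Tendsto (fun n => starPotential p (w n)) atTop (𝓝 (∫ x, ‖v' x‖ ^ p)) := by
    simp_rw [e3]
    simpa using (tendsto_setIntegral_Ioi_neg ip).add hp00
  -- This factor restores the mass `m` once the mass of `w n` is positive, which is guaranteed only
  -- for large `n`.
  set c : ℕ → ℝ := fun n => √(m / starMass (w n)) with hc
  have tc : Tendsto c atTop (𝓝 1) := by
    have := (tendsto_const_nhds (x := m).div t1 hm.ne').sqrt
    simpa [div_self hm.ne'] using this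
  have hc0 : ∀ n, 0 ≤ c n := fun n => Real.sqrt_nonneg _
  refine ⟨fun n => c n • w n, ?_, ?_⟩
  · filter_upwards [t1.eventually (lt_mem_nhds hm)] with n hn
    refine ⟨((hw n).smul _).memH1Star, ?_⟩
    rw [starMass_smul, hc, Real.sq_sqrt (by positivity)]
    field_simp
  · have e : ∀ n, starEnergy p q (c n • w n) = (c n) ^ 2 * (1 / 2 * starKinetic (w n))
        - (c n) ^ p * (1 / p * starPotential p (w n)) - (c n) ^ q * (1 / q * ‖a n‖ ^ q) := fun n => by
      rw [(hw n).memH1Star.starEnergy_smul (hc0 n), hw0]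
    simp_rw [e]
    rw [hpair.lineEnergy_eq]
    have tq := (tc.rpow_const (p := q) (Or.inr hq0.le)).mul
      ((ha0.rpow_const (p := q) (Or.inr hq0.le)).const_mul (1 / q))
    have tp := (tc.rpow_const (p := p) (Or.inr hp0.le)).mul (t3.const_mul (1 / p))
    have tk := (tc.pow 2).mul (t2.const_mul (1 / 2))
    simpa [Real.zero_rpow hq0.ne'] using (tk.sub tp).sub tq

theorem starLevel_le_lineLevel {p q m : ℝ} (hp : 2 < p) (hq : 2 < q) (hm : 0 < m) :
    starLevel 𝕜 N p q m ≤ lineLevel 𝕜 p m := by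
  refine le_iInf₂ fun v hv => ?_
  obtain ⟨w, hw, hlim⟩ := exists_seq_tendsto_lineEnergy (N := N) hp hq hm hv
  refine ge_of_tendsto ((continuous_coe_real_ereal.tendsto _).comp hlim) ?_
  filter_upwards [hw] with n hn
  exact iInf₂_le (w n) hn

end level

end StarNLS

/-! ### Splitting of bounded sequences, mass scaling and cutting at the vertex -/

namespace StarNLS

section

variable {𝕜 : Type*} [RCLike 𝕜] {N : ℕ}

/-- `w n → u` pointwise, and mass, kinetic energy and potential energy split asymptotically into
the parts of `u` and of `w n - u`. -/
structure SplitsTo (p : ℝ) (w : ℕ → Fin N → ℝ → 𝕜) (u : Fin N → ℝ → 𝕜) : Prop where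
  pointwise : ∀ i x, 0 ≤ x → Tendsto (fun n => w n i x) atTop (𝓝 (u i x))
  mass : Tendsto (fun n => starMass (w n) - starMass (w n - u)) atTop (𝓝 (starMass u))
  kinetic : Tendsto (fun n => starKinetic (w n) - starKinetic (w n - u)) atTop (𝓝 (starKinetic u))
  potential : Tendsto (fun n => starPotential p (w n) - starPotential p (w n - u)) atTop
    (𝓝 (starPotential p u))

/-- Bounded sequences in `H¹(S_N)` have a subsequence that splits. -/
theorem exists_subseq_splitsTo [NeZero N] {p A B : ℝ} (hp : 2 ≤ p) {w : ℕ → Fin N → ℝ → 𝕜}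
    (hw : ∀ n, MemH1Star (w n)) (hA : ∀ n, starMass (w n) ≤ A) (hB : ∀ n, starKinetic (w n) ≤ B) :
    ∃ u : Fin N → ℝ → 𝕜, MemH1Star u ∧ ∃ k : ℕ → ℕ, StrictMono k ∧
      SplitsTo p (fun n => w (k n)) u := by
  set G : ℕ → Fin N → ℝ → 𝕜 := fun n i => weakDeriv (Ioi 0) (w n i) with hGdef
  have hpair : ∀ n, IsStarPair (w n) (G n) := fun n => (hw n).isStarPair
  set M := √(2 * A + 2 * B)
  have hM : ∀ n i x, 0 ≤ x → ‖w n i x‖ ≤ M := fun n i x hx => (hw n).norm_le (hA n) (hB n) hx i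
  obtain ⟨k₁, hk₁, hweak⟩ := exists_common_subseq
    (fun (i : Fin N) (k : ℕ → ℕ) => ∃ g, MemLp g 2 (volume.restrict (Ioi 0)) ∧
      WeakL2Tendsto (volume.restrict (Ioi 0)) (fun n => G (k n) i) g)
    (fun i k _ => by
      obtain ⟨g, hg, j, hj, h⟩ := exists_subseq_weakL2Tendsto (μ := volume.restrict (Ioi 0))
        (G := fun n => G (k n) i) (A := B) (fun n => ((hpair (k n)).pair i).memLp_deriv)
        (fun n => ((hpair (k n)).integral_le_starKinetic i).trans (hB _))
      exact ⟨j, hj, g, hg, h⟩)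
    (fun i k j ⟨g, hg, h⟩ hj => ⟨g, hg, h.comp hj⟩)
  choose g hg hweak using hweak
  -- Weak convergence of derivatives fixes the limit only up to a constant; a convergent subsequence
  -- of vertex values supplies it.
  obtain ⟨a, -, k₂, hk₂, ha⟩ := tendsto_subseq_of_bounded (x := fun n => w (k₁ n) 0 0)
    (Metric.isBounded_closedBall (x := (0 : 𝕜)) (r := M))
    (fun n => by simpa using hM (k₁ n) 0 0 le_rfl)
  set k := k₁ ∘ k₂
  set u : Fin N → ℝ → 𝕜 := fun i x => a + ∫ y in (0 : ℝ)..x, g i y with hu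
  have hweak' : ∀ i, WeakL2Tendsto (volume.restrict (Ioi 0)) (fun n => G (k n) i) (g i) :=
    fun i => (hweak i).comp hk₂
  have hpt : ∀ i x, 0 ≤ x → Tendsto (fun n => w (k n) i x) atTop (𝓝 (u i x)) := by
    intro i x hx
    have h1 := ha.add ((hweak' i).tendsto_primitive hx)
    refine h1.congr fun n => ?_
    rw [((hpair (k n)).pair i).ftc x (by simpa using hx), (hpair (k n)).vertex i 0]
    rfl
  have hae : ∀ i, ∀ᵐ x ∂volume.restrict (Ioi 0),
      Tendsto (fun n => w (k n) i x) atTop (𝓝 (u i x)) := fun i =>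
    ae_restrict_of_forall_mem measurableSet_Ioi fun x hx => hpt i x (le_of_lt hx)
  have hmassi : ∀ n i, ∫ x in Ioi 0, ‖w (k n) i x‖ ^ 2 ≤ A := fun n i =>
    (integral_le_starMass _ i).trans (hA _)
  have hmem : ∀ n i, MemLp (w (k n) i) 2 (volume.restrict (Ioi 0)) := fun n i =>
    ((hpair (k n)).pair i).memLp
  have humem : ∀ i, MemLp (u i) 2 (volume.restrict (Ioi 0)) := fun i =>
    memLp_two_of_tendsto (fun n => hmem n i) (fun n => hmassi n i) (hae i)
  have hupair : IsStarPair u g := ⟨fun i => ⟨humem i, hg i, fun x _ => by simp [hu]⟩,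
    fun i j => by simp [hu]⟩
  have hMae : ∀ n i, ∀ᵐ x ∂volume.restrict (Ioi 0), ‖w (k n) i x‖ ≤ M := fun n i =>
    ae_restrict_of_forall_mem measurableSet_Ioi fun x hx => hM _ i x (le_of_lt hx)
  have huM : ∀ i, ∀ᵐ x ∂volume.restrict (Ioi 0), ‖u i x‖ ≤ M := fun i =>
    ae_restrict_of_forall_mem measurableSet_Ioi fun x hx =>
      le_of_tendsto' (hpt i x (le_of_lt hx)).norm fun n => hM _ i x (le_of_lt hx)
  have hBL : ∀ r : ℝ, 2 ≤ r → ∀ i, Tendsto (fun n => (∫ x in Ioi 0, ‖w (k n) i x‖ ^ r)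
      - ∫ x in Ioi 0, ‖w (k n) i x - u i x‖ ^ r) atTop (𝓝 (∫ x in Ioi 0, ‖u i x‖ ^ r)) :=
    fun r hr i => tendsto_integral_rpow_sub hr (fun n => hmem n i) (humem i) (hae i)
      (fun n => hMae n i) (huM i) (fun n => hmassi n i)
  refine ⟨u, hupair.memH1Star, k, hk₁.comp hk₂, hpt, ?_, ?_, ?_⟩
  · have h := tendsto_finsetSum Finset.univ fun i _ => hBL 2 le_rfl i
    simp only [Finset.sum_sub_distrib, Real.rpow_two] at h
    exact h
  · have h := tendsto_finsetSum Finset.univ fun i _ => (hweak' i).tendsto_integral_sq_sub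
      (fun n => ((hpair (k n)).pair i).memLp_deriv) (hg i)
    rw [hupair.starKinetic_eq]
    refine h.congr fun n => ?_
    rw [(hpair (k n)).starKinetic_eq, ((hpair (k n)).sub hupair).starKinetic_eq,
      Finset.sum_sub_distrib]
    rfl
  · have h := tendsto_finsetSum Finset.univ fun i _ => hBL p hp i
    simp only [Finset.sum_sub_distrib] at h
    exact h

/-- Source of the strict inequality under mass scaling. -/
theorem MemH1Star.starPotential_pos {u : Fin N → ℝ → 𝕜} (hu : MemH1Star u) {p : ℝ} (hp : 2 ≤ p)
    (hm : 0 < starMass u) : 0 < starPotential p u := by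
  obtain ⟨i, -, hi⟩ := Finset.exists_lt_of_sum_lt (s := Finset.univ)
    (f := fun _ : Fin N => (0 : ℝ)) (Finset.sum_const_zero.trans_lt hm)
  have hint : Integrable (fun x => ‖u i x‖ ^ p) (volume.restrict (Ioi 0)) :=
    integrable_rpow_norm_of_bound hp (hu.memH1 i).1 (ae_restrict_of_forall_mem measurableSet_Ioi
      fun x hx => hu.norm_le le_rfl le_rfl (le_of_lt hx) i)
  refine lt_of_lt_of_le ?_ (Finset.single_le_sum (f := fun i => ∫ x in Ioi 0, ‖u i x‖ ^ p)
    (fun _ _ => integral_nonneg fun _ => by positivity) (Finset.mem_univ i))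
  refine lt_of_le_of_ne (integral_nonneg fun _ => by positivity) fun h0 => hi.ne' ?_
  rw [eq_comm, integral_eq_zero_iff_of_nonneg (fun _ => by positivity) hint] at h0
  rw [integral_eq_zero_iff_of_nonneg (fun _ => by positivity) (integrable_sq_of_memLp (hu.memH1 i).1)]
  filter_upwards [h0] with x hx
  have : ‖u i x‖ = 0 := (Real.rpow_eq_zero (norm_nonneg _) (by linarith)).1 hx
  simp [this]

/-- Scaling up to the mass `m` gives a lower bound for the energy at smaller masses. -/
theorem MemH1Star.mul_le_starEnergy [NeZero N] {p q m f : ℝ} (hp : 2 < p) (hq : 2 < q)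
    (hf : ∀ u ∈ H1MassStar 𝕜 N m, f ≤ starEnergy p q u) {u : Fin N → ℝ → 𝕜} (hu : MemH1Star u)
    (h0 : 0 < starMass u) (hle : starMass u ≤ m) :
    starMass u / m * f ≤ starEnergy p q u ∧
      (starMass u < m → starMass u / m * f < starEnergy p q u) := by
  have hm : 0 < m := h0.trans_le hle
  set c := √(m / starMass u) with hc
  have hc2 : c ^ 2 = m / starMass u := Real.sq_sqrt (by positivity)
  have hc0 : 0 ≤ c := Real.sqrt_nonneg _
  have h1 := hf (c • u) ⟨hu.smul c, by rw [starMass_smul, hc2]; field_simp⟩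
  have hP := hu.starPotential_pos hp.le h0
  have hc1 : 1 ≤ c := by
    rw [hc, Real.one_le_sqrt, one_le_div h0]; exact hle
  have hcp : ∀ r : ℝ, 2 ≤ r → c ^ 2 ≤ c ^ r := fun r hr => by
    rw [← Real.rpow_two]; exact Real.rpow_le_rpow_of_exponent_le hc1 hr
  rw [hu.starEnergy_smul hc0] at h1
  have hV : 0 ≤ 1 / q * ‖u 0 0‖ ^ q := by positivity
  have hPp : 0 < 1 / p * starPotential p u := by positivity
  -- Scaling by `c ≥ 1` multiplies the energy by `c ^ 2` up to corrections of favourable sign, since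
  -- `p` and `q` exceed `2`. No sign of `f` is needed.
  have h2 : f ≤ c ^ 2 * starEnergy p q u
      - (c ^ p - c ^ 2) * (1 / p * starPotential p u) - (c ^ q - c ^ 2) * (1 / q * ‖u 0 0‖ ^ q) := by
    rw [starEnergy_eq]; linarith
  have h3 : 0 ≤ (c ^ q - c ^ 2) * (1 / q * ‖u 0 0‖ ^ q) :=
    mul_nonneg (sub_nonneg.2 (hcp q hq.le)) hV
  have h4 : 0 ≤ (c ^ p - c ^ 2) * (1 / p * starPotential p u) :=
    mul_nonneg (sub_nonneg.2 (hcp p hp.le)) hPp.le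
  have hcm : starMass u / m * c ^ 2 = 1 := by rw [hc2]; field_simp
  have hmm : 0 < starMass u / m := by positivity
  constructor
  · calc starMass u / m * f ≤ starMass u / m * (c ^ 2 * starEnergy p q u) := by
          gcongr; linarith
      _ = starEnergy p q u := by rw [← mul_assoc, hcm, one_mul]
  · intro hlt
    have hc1' : 1 < c := by
      rw [hc, Real.lt_sqrt zero_le_one, one_pow, one_lt_div h0]; exact hlt
    have h5 : 0 < (c ^ p - c ^ 2) * (1 / p * starPotential p u) := by
      refine mul_pos (sub_pos.2 ?_) hPp
      rw [← Real.rpow_two]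
      exact Real.rpow_lt_rpow_of_exponent_lt hc1' hp
    calc starMass u / m * f < starMass u / m * (c ^ 2 * starEnergy p q u) := by
          gcongr; linarith
      _ = starEnergy p q u := by rw [← mul_assoc, hcm, one_mul]

/-- The scaling bound on the line. Zero mass is allowed, because a single branch of a star function
may vanish. -/
theorem IsH1Pair.mul_le_lineEnergy {p m e : ℝ} (hp : 2 < p)
    (he : ∀ v ∈ H1MassLine 𝕜 m, e ≤ lineEnergy p v) {v g : ℝ → 𝕜} (h : IsH1Pair univ v g)
    (hm : 0 < m) (hle : ∫ x, ‖v x‖ ^ 2 ≤ m) :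
    (∫ x, ‖v x‖ ^ 2) / m * e ≤ lineEnergy p v := by
  set m' := ∫ x, ‖v x‖ ^ 2 with hm'
  have hm'0 : 0 ≤ m' := integral_nonneg fun _ => by positivity
  have iu : Integrable fun y => ‖v y‖ ^ 2 := by simpa using integrable_sq_of_memLp h.memLp
  have hPnn : 0 ≤ ∫ x, ‖v x‖ ^ p := integral_nonneg fun _ => by positivity
  have hKnn : 0 ≤ ∫ x, ‖g x‖ ^ 2 := integral_nonneg fun _ => by positivity
  rcases hm'0.eq_or_lt with h0 | h0
  · have hv0 : (fun x => ‖v x‖ ^ 2) =ᵐ[volume] 0 :=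
      (integral_eq_zero_iff_of_nonneg (fun _ => by positivity) iu).1 h0.symm
    have hP0 : ∫ x, ‖v x‖ ^ p = 0 := by
      rw [← integral_zero ℝ ℝ (μ := volume)]
      refine integral_congr_ae ?_
      filter_upwards [hv0] with x hx
      have : ‖v x‖ = 0 := by simpa using hx
      rw [this, Real.zero_rpow (by linarith)]
    rw [← h0, h.lineEnergy_eq, hP0, zero_div, zero_mul, mul_zero, sub_zero]
    positivity
  · set c := √(m / m') with hc
    have hc2 : c ^ 2 = m / m' := Real.sq_sqrt (by positivity)
    have hc0 : 0 ≤ c := Real.sqrt_nonneg _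
    have hc1 : 1 ≤ c := by
      rw [hc, Real.one_le_sqrt, one_le_div h0]; exact hle
    have hcp : c ^ 2 ≤ c ^ p := by
      rw [← Real.rpow_two]; exact Real.rpow_le_rpow_of_exponent_le hc1 hp.le
    have hs := h.smul c
    have h1 := he (c • v) ⟨hs.memH1 isBasedInterval_univ, by
      simp only [Pi.smul_apply, norm_smul, mul_pow, Real.norm_eq_abs, sq_abs, integral_const_mul]
      rw [hc2, ← hm']; field_simp⟩
    rw [hs.lineEnergy_eq] at h1
    simp only [Pi.smul_apply, norm_smul, mul_pow, Real.norm_eq_abs,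
      abs_of_nonneg hc0, Real.mul_rpow hc0 (norm_nonneg _), integral_const_mul] at h1
    have h2 : 0 ≤ (c ^ p - c ^ 2) * (1 / p * ∫ x, ‖v x‖ ^ p) :=
      mul_nonneg (sub_nonneg.2 hcp) (by positivity)
    have h3 : e ≤ c ^ 2 * lineEnergy p v := by
      rw [h.lineEnergy_eq]; linarith
    have hcm : m' / m * c ^ 2 = 1 := by rw [hc2]; field_simp
    calc m' / m * e ≤ m' / m * (c ^ 2 * lineEnergy p v) := by gcongr
      _ = lineEnergy p v := by rw [← mul_assoc, hcm, one_mul]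

/-- Comparison with the line: cutting a function on the star graph at the vertex. -/
theorem MemH1Star.le_of_le_lineEnergy [NeZero N] {p m e : ℝ} (hp : 2 < p) (hm : 0 < m)
    (he : ∀ v ∈ H1MassLine 𝕜 m, e ≤ lineEnergy p v) {u : Fin N → ℝ → 𝕜} (hu : MemH1Star u)
    (hmass : starMass u = m) {s : ℝ} (hs0 : 0 ≤ s)
    (hs : s ^ 2 * (m + N * (‖u 0 0‖ ^ 2 / 2)) = m) :
    e ≤ s ^ 2 * (1 / 2 * (starKinetic u + N * (‖u 0 0‖ ^ 2 / 2)))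
      - s ^ p * (1 / p * (starPotential p u + N * (‖u 0 0‖ ^ p / p))) := by
  have hp0 : 0 < p := by linarith
  have hpair := hu.isStarPair
  set G := fun i => weakDeriv (Ioi 0) (u i)
  set a := u 0 0
  have hint : ∀ i, IntegrableOn (fun x => ‖u i x‖ ^ p) (Ioi 0) := fun i =>
    integrable_rpow_norm_of_bound hp.le (hu.memH1 i).1 (ae_restrict_of_forall_mem measurableSet_Ioi
      fun x hx => hu.norm_le le_rfl le_rfl (le_of_lt hx) i)
  -- Each branch with its exponential tail, scaled by `s`, is a function on the line with mass at
  -- most `m`. The shares multiplying `e` add up to one by the choice of `s`.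
  have key : ∀ i, s ^ 2 * ((∫ x in Ioi 0, ‖u i x‖ ^ 2) + ‖a‖ ^ 2 / 2) / m * e
      ≤ s ^ 2 * (1 / 2 * ((∫ x in Ioi 0, ‖G i x‖ ^ 2) + ‖a‖ ^ 2 / 2))
        - s ^ p * (1 / p * ((∫ x in Ioi 0, ‖u i x‖ ^ p) + ‖a‖ ^ p / p)) := by
    intro i
    have hgl := (hpair.pair i).glue_exp.smul s
    have hi : u i 0 = a := hu.vertex i 0
    rw [hi] at hgl
    have hM : ∫ x, ‖(s • (Ioi (0:ℝ)).piecewise (u i) fun x => Real.exp x • a) x‖ ^ 2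
        = s ^ 2 * ((∫ x in Ioi 0, ‖u i x‖ ^ 2) + ‖a‖ ^ 2 / 2) := by
      rw [← integral_norm_sq_piecewise a (hu.memH1 i).1, ← integral_const_mul]
      simp only [Pi.smul_apply, norm_smul, mul_pow, Real.norm_eq_abs, sq_abs]
    have hK : ∫ x, ‖(s • (Ioi (0:ℝ)).piecewise (G i) fun x => Real.exp x • a) x‖ ^ 2
        = s ^ 2 * ((∫ x in Ioi 0, ‖G i x‖ ^ 2) + ‖a‖ ^ 2 / 2) := by
      rw [← integral_norm_sq_piecewise a (hpair.pair i).memLp_deriv, ← integral_const_mul]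
      simp only [Pi.smul_apply, norm_smul, mul_pow, Real.norm_eq_abs, sq_abs]
    have hP : ∫ x, ‖(s • (Ioi (0:ℝ)).piecewise (u i) fun x => Real.exp x • a) x‖ ^ p
        = s ^ p * ((∫ x in Ioi 0, ‖u i x‖ ^ p) + ‖a‖ ^ p / p) := by
      rw [← integral_norm_rpow_piecewise hp0 a (hint i), ← integral_const_mul]
      simp only [Pi.smul_apply, norm_smul, Real.norm_eq_abs, abs_of_nonneg hs0,
        Real.mul_rpow hs0 (norm_nonneg _)]
    have h1 := hgl.mul_le_lineEnergy hp he hm (by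
      rw [hM]
      refine le_trans ?_ hs.le
      have h2 := integral_le_starMass u i
      have h3 : (1 : ℝ) ≤ N := by exact_mod_cast Nat.one_le_iff_ne_zero.2 (NeZero.ne N)
      rw [hmass] at h2
      have h4 : ‖a‖ ^ 2 / 2 ≤ N * (‖a‖ ^ 2 / 2) := le_mul_of_one_le_left (by positivity) h3
      gcongr)
    rw [hM, hgl.lineEnergy_eq, hK, hP] at h1
    linarith
  have hsum := Finset.sum_le_sum fun i (_ : i ∈ Finset.univ) => key i
  have hadd : ∀ (x : Fin N → ℝ) (b : ℝ), ∑ i, (x i + b) = (∑ i, x i) + N * b := fun x b => by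
    simp [Finset.sum_add_distrib]
  rw [Finset.sum_sub_distrib, ← Finset.sum_mul, ← Finset.sum_div, ← Finset.mul_sum,
    ← Finset.mul_sum, ← Finset.mul_sum, ← Finset.mul_sum, ← Finset.mul_sum, hadd, hadd, hadd] at hsum
  have hMs : ∑ i, ∫ x in Ioi 0, ‖u i x‖ ^ 2 = m := hmass
  have hKs : ∑ i, ∫ x in Ioi 0, ‖G i x‖ ^ 2 = starKinetic u := rfl
  have hPs : ∑ i, ∫ x in Ioi 0, ‖u i x‖ ^ p = starPotential p u := rfl
  rw [hMs, hKs, hPs, hs, div_self hm.ne', one_mul] at hsum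
  exact hsum

end

end StarNLS

/-! ### Excluding vanishing and dichotomy; compactness of minimizing sequences -/

namespace StarNLS

section

variable {𝕜 : Type*} [RCLike 𝕜] {N : ℕ} [NeZero N] {p q m f : ℝ}

/-- With zero mass the Sobolev inequality leaves only the term `2 * d * starKinetic u`, and `d` is
arbitrarily small. -/
theorem MemH1Star.vertex_eq_zero_of_starMass_eq_zero {u : Fin N → ℝ → 𝕜} (hu : MemH1Star u)
    (h0 : starMass u = 0) : u 0 0 = 0 := by
  have hlim : Tendsto (fun d : ℝ => 2 * d * starKinetic u) (𝓝[>] 0) (𝓝 0) := by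
    have : Continuous fun d : ℝ => 2 * d * starKinetic u := by fun_prop
    simpa using (this.tendsto 0).mono_left nhdsWithin_le_nhds
  have h1 : ‖u 0 0‖ ^ 2 ≤ 0 := by
    refine ge_of_tendsto hlim ?_
    filter_upwards [self_mem_nhdsWithin] with d hd
    simpa [h0] using hu.sq_norm_le (mem_Ioi.1 hd) le_rfl 0
  have h2 : ‖u 0 0‖ ^ 2 = 0 := le_antisymm h1 (by positivity)
  simpa using h2

/-- A bounded minimizing sequence that vanishes at the vertex is no better than the line. -/
theorem le_of_tendsto_vertex_zero {e B : ℝ} (hp : 2 < p) (hq : 2 < q) (hm : 0 < m)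
    (he : ∀ v ∈ H1MassLine 𝕜 m, e ≤ lineEnergy p v) {w : ℕ → Fin N → ℝ → 𝕜}
    (hw : ∀ n, w n ∈ H1MassStar 𝕜 N m) (hB : ∀ n, starKinetic (w n) ≤ B)
    (hlim : Tendsto (fun n => starEnergy p q (w n)) atTop (𝓝 f))
    (hv : Tendsto (fun n => w n 0 0) atTop (𝓝 0)) : e ≤ f := by
  have hp0 : 0 < p := by linarith
  have hq0 : 0 < q := by linarith
  have ha : Tendsto (fun n => ‖w n 0 0‖) atTop (𝓝 0) := by simpa using hv.norm
  set b : ℕ → ℝ := fun n => N * (‖w n 0 0‖ ^ 2 / 2) with hb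
  have hb0 : ∀ n, 0 ≤ b n := fun n => by positivity
  have tb : Tendsto b atTop (𝓝 0) := by
    simpa using ((ha.pow 2).div_const 2).const_mul (N : ℝ)
  set c : ℕ → ℝ := fun n => N * (‖w n 0 0‖ ^ p / p) with hc
  have tc : Tendsto c atTop (𝓝 0) := by
    simpa [Real.zero_rpow hp0.ne'] using
      ((ha.rpow_const (p := p) (Or.inr hp0.le)).div_const p).const_mul (N : ℝ)
  have tV : Tendsto (fun n => 1 / q * ‖w n 0 0‖ ^ q) atTop (𝓝 0) := by
    simpa [Real.zero_rpow hq0.ne'] using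
      (ha.rpow_const (p := q) (Or.inr hq0.le)).const_mul (1 / q)
  set s : ℕ → ℝ := fun n => √(m / (m + b n)) with hs
  have ts : Tendsto s atTop (𝓝 1) := by
    have h1 : Tendsto (fun n => m + b n) atTop (𝓝 m) := by simpa using tb.const_add m
    have := (tendsto_const_nhds (x := m).div h1 hm.ne').sqrt
    simpa [div_self hm.ne'] using this
  have hs2 : ∀ n, s n ^ 2 * (m + b n) = m := fun n => by
    have := hb0 n
    rw [hs, Real.sq_sqrt (by positivity)]
    field_simp
  have key := fun n => (hw n).1.le_of_le_lineEnergy hp hm he (hw n).2 (Real.sqrt_nonneg _) (hs2 n)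
  have tbd : ∀ (x y : ℕ → ℝ) (C : ℝ), Tendsto x atTop (𝓝 1) → (∀ n, 0 ≤ y n) → (∀ n, y n ≤ C) →
      Tendsto (fun n => (x n - 1) * y n) atTop (𝓝 0) := by
    intro x y C hx h0 hC
    have h1 : Tendsto (fun n => |x n - 1| * C) atTop (𝓝 0) := by
      simpa using ((hx.sub_const 1).abs).mul_const C
    refine squeeze_zero_norm (fun n => ?_) h1
    rw [norm_mul, Real.norm_eq_abs, Real.norm_of_nonneg (h0 n)]
    gcongr
    exact hC n
  have hP : ∀ n, starPotential p (w n) ≤ √(2 * m + 2 * B) ^ (p - 2) * m := fun n => by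
    have := (hw n).1.starPotential_le hp.le
      fun i x hx => (hw n).1.norm_le (hw n).2.le (hB n) hx i
    rwa [(hw n).2] at this
  have t1 := tbd (fun n => s n ^ 2) (fun n => starKinetic (w n)) B (by simpa using ts.pow 2)
    (fun n => starKinetic_nonneg _) hB
  have t2 := tbd (fun n => s n ^ p) (fun n => starPotential p (w n)) _
    (by simpa using ts.rpow_const (p := p) (Or.inr hp0.le)) (fun n => starPotential_nonneg _ _) hP
  -- The right-hand side of `key` is the energy of `w n` plus corrections tending to zero: changes
  -- of scale on bounded quantities, the vertex term and the tails.
  have t3 := (((hlim.add (t1.const_mul (1 / 2))).sub (t2.const_mul (1 / p))).add tV).add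
    ((((ts.pow 2).mul tb).const_mul (1 / 2)).sub
      (((ts.rpow_const (p := p) (Or.inr hp0.le)).mul tc).const_mul (1 / p)))
  simp only [mul_zero, add_zero, sub_zero] at t3
  refine ge_of_tendsto' t3 fun n => (key n).trans (le_of_eq ?_)
  rw [starEnergy_eq]
  simp only [hb, hc, hs]
  ring

theorem SplitsTo.tendsto_vertex {w : ℕ → Fin N → ℝ → 𝕜} {u : Fin N → ℝ → 𝕜}
    (h : SplitsTo p w u) (hq : 0 < q) :
    Tendsto (fun n => 1 / q * ‖w n 0 0‖ ^ q) atTop (𝓝 (1 / q * ‖u 0 0‖ ^ q)) :=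
  ((h.pointwise 0 0 le_rfl).norm.rpow_const (Or.inr hq.le)).const_mul _

/-- A weak limit of a minimizing sequence carries either all of the mass or none of it. -/
theorem SplitsTo.not_dichotomy {w : ℕ → Fin N → ℝ → 𝕜} {u : Fin N → ℝ → 𝕜}
    (h : SplitsTo p w u) (hp : 2 < p) (hq : 2 < q) (hu : MemH1Star u)
    (hf : ∀ u ∈ H1MassStar 𝕜 N m, f ≤ starEnergy p q u)
    (hw : ∀ n, w n ∈ H1MassStar 𝕜 N m)
    (hlim : Tendsto (fun n => starEnergy p q (w n)) atTop (𝓝 f))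
    (h0 : 0 < starMass u) (hlt : starMass u < m) : False := by
  have hq0 : 0 < q := by linarith
  have hm : 0 < m := h0.trans hlt
  have hmass : Tendsto (fun n => starMass (w n - u)) atTop (𝓝 (m - starMass u)) := by
    refine (h.mass.const_sub m).congr fun n => ?_
    rw [(hw n).2]; ring
  have hvz : Tendsto (fun n => 1 / q * ‖(w n - u) 0 0‖ ^ q) atTop (𝓝 0) := by
    have h1 : Tendsto (fun n => ‖(w n - u) 0 0‖) atTop (𝓝 0) := by
      simpa using ((h.pointwise 0 0 le_rfl).sub_const (u 0 0)).norm
    simpa [Real.zero_rpow hq0.ne'] using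
      (h1.rpow_const (p := q) (Or.inr hq0.le)).const_mul (1 / q)
  have hE : Tendsto (fun n => starEnergy p q (w n - u)) atTop (𝓝 (f - starEnergy p q u)) := by
    have h1 := hlim.sub ((((h.kinetic.const_mul (1 / 2)).sub (h.potential.const_mul (1 / p))).sub
      (h.tendsto_vertex hq0)).add hvz)
    rw [add_zero, ← starEnergy_eq] at h1
    refine h1.congr fun n => ?_
    rw [starEnergy_eq, starEnergy_eq]
    ring
  -- The remainder is eventually of mass in `(0, m)`, so the scaling bound gives it the share `(m -
  -- starMass u) / m` of `f`.
  have hge : (m - starMass u) / m * f ≤ f - starEnergy p q u := by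
    refine le_of_tendsto_of_tendsto ((hmass.div_const m).mul_const f) hE ?_
    filter_upwards [hmass.eventually (lt_mem_nhds (sub_pos.2 hlt)),
      hmass.eventually (gt_mem_nhds (by linarith : m - starMass u < m))] with n h1 h2
    exact (((hw n).1.sub hu).mul_le_starEnergy hp hq hf h1 h2.le).1
  have hgt := (hu.mul_le_starEnergy hp hq hf h0 hlt.le).2 hlt
  have : (m - starMass u) / m * f = f - starMass u / m * f := by
    field_simp
  linarith

/-- If the weak limit carries all of the mass, then the convergence is strong. -/
theorem SplitsTo.strong_of_starMass_eq {B : ℝ} {w : ℕ → Fin N → ℝ → 𝕜} {u : Fin N → ℝ → 𝕜}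
    (h : SplitsTo p w u) (hp : 2 < p) (hq : 2 < q) (hu : MemH1Star u)
    (hf : ∀ u ∈ H1MassStar 𝕜 N m, f ≤ starEnergy p q u)
    (hw : ∀ n, w n ∈ H1MassStar 𝕜 N m) (hB : ∀ n, starKinetic (w n) ≤ B)
    (hlim : Tendsto (fun n => starEnergy p q (w n)) atTop (𝓝 f)) (hm : starMass u = m) :
    starEnergy p q u = f ∧ Tendsto (fun n => starH1NormSq (w n - u)) atTop (𝓝 0) := by
  have hq0 : 0 < q := by linarith
  have hmass : Tendsto (fun n => starMass (w n - u)) atTop (𝓝 0) := by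
    have h1 := h.mass.const_sub m
    rw [hm, sub_self] at h1
    refine h1.congr fun n => ?_
    rw [(hw n).2]; ring
  set M := √(2 * m + 2 * B) + √(2 * m + 2 * starKinetic u)
  have hP0 : Tendsto (fun n => starPotential p (w n - u)) atTop (𝓝 0) := by
    have h1 : Tendsto (fun n => M ^ (p - 2) * starMass (w n - u)) atTop (𝓝 0) := by
      simpa using hmass.const_mul (M ^ (p - 2))
    refine squeeze_zero (fun n => starPotential_nonneg _ _) (fun n => ?_) h1
    refine ((hw n).1.sub hu).starPotential_le hp.le fun i x hx => ?_
    exact (norm_sub_le _ _).trans (add_le_add ((hw n).1.norm_le (hw n).2.le (hB n) hx i)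
      (hu.norm_le hm.le le_rfl hx i))
  have hP : Tendsto (fun n => starPotential p (w n)) atTop (𝓝 (starPotential p u)) := by
    simpa using h.potential.add hP0
  -- The limit of the kinetic energies, read off from the limits of the other terms of the energy.
  set κ := 2 * (f + 1 / p * starPotential p u + 1 / q * ‖u 0 0‖ ^ q) with hκ
  have hK : Tendsto (fun n => starKinetic (w n)) atTop (𝓝 κ) := by
    refine (((hlim.add (hP.const_mul (1 / p))).add (h.tendsto_vertex hq0)).const_mul 2).congr
      fun n => ?_
    rw [starEnergy_eq]; ring
  have hKs : Tendsto (fun n => starKinetic (w n - u)) atTop (𝓝 (κ - starKinetic u)) := by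
    simpa using hK.sub h.kinetic
  -- Nonnegativity of the remainder's kinetic energy bounds `κ` below by that of `u`; admissibility
  -- of `u` for the infimum gives the reverse.
  have h1 : 0 ≤ κ - starKinetic u := ge_of_tendsto' hKs fun n => starKinetic_nonneg _
  have h2 := hf u ⟨hu, hm⟩
  have h3 : κ = starKinetic u := by
    rw [starEnergy_eq] at h2
    linarith
  refine ⟨?_, ?_⟩
  · rw [starEnergy_eq, ← h3, hκ]; ring
  · rw [h3, sub_self] at hKs
    simpa [starH1NormSq] using hmass.add hKs

/-- Below the level of the line, minimizing sequences are relatively compact. -/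
theorem exists_subseq_tendsto_of_lt {e : ℝ} (hp2 : 2 < p) (hp6 : p < 6) (hq2 : 2 < q)
    (hq4 : q < 4) (hm : 0 < m) (he : ∀ v ∈ H1MassLine 𝕜 m, e ≤ lineEnergy p v) (hfe : f < e)
    (hf : ∀ u ∈ H1MassStar 𝕜 N m, f ≤ starEnergy p q u) {w : ℕ → Fin N → ℝ → 𝕜}
    (hw : ∀ n, w n ∈ H1MassStar 𝕜 N m)
    (hlim : Tendsto (fun n => starEnergy p q (w n)) atTop (𝓝 f)) :
    ∃ u ∈ H1MassStar 𝕜 N m, starEnergy p q u = f ∧ ∃ k : ℕ → ℕ, StrictMono k ∧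
      Tendsto (fun n => starH1NormSq (w (k n) - u)) atTop (𝓝 0) := by
  obtain ⟨B, hB⟩ := exists_starKinetic_le_starEnergy 𝕜 N hp2 hp6 hq2 hq4 hm
  obtain ⟨A, hA⟩ := hlim.bddAbove_range
  have hK : ∀ n, starKinetic (w n) ≤ 4 * (A + B) := fun n => by
    have h1 := hB (w n) (hw n).1 (hw n).2
    have h2 := hA (mem_range_self n)
    linarith
  obtain ⟨u, hu, k, hk, hs⟩ := exists_subseq_splitsTo hp2.le (fun n => (hw n).1)
    (fun n => (hw n).2.le) hK
  have hlimk := hlim.comp hk.tendsto_atTop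
  have hle : starMass u ≤ m := le_of_tendsto' hs.mass fun n => by
    rw [(hw (k n)).2]
    linarith [starMass_nonneg (w (k n) - u)]
  rcases (starMass_nonneg u).eq_or_lt with h0 | h0
  · refine absurd (le_of_tendsto_vertex_zero hp2 hq2 hm he (fun n => hw (k n)) (fun n => hK (k n))
      hlimk ?_) (not_le.2 hfe)
    simpa [hu.vertex_eq_zero_of_starMass_eq_zero h0.symm] using hs.pointwise 0 0 le_rfl
  rcases hle.eq_or_lt with h1 | h1
  · obtain ⟨h2, h3⟩ := hs.strong_of_starMass_eq hp2 hq2 hu hf (fun n => hw (k n))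
      (fun n => hK (k n)) hlimk h1
    exact ⟨u, ⟨hu, h1⟩, h2, k, hk, h3⟩
  · exact (hs.not_dichotomy hp2 hq2 hu hf (fun n => hw (k n)) hlimk h0 h1).elim

/-- Coercivity excludes `⊥`, so the level is a real number and the estimates can be run over the
reals. -/
theorem exists_starLevel_eq_coe (hp2 : 2 < p) (hp6 : p < 6) (hq2 : 2 < q) (hq4 : q < 4)
    (hm : 0 < m) (hlt : starLevel 𝕜 N p q m < ⊤) : ∃ f : ℝ, starLevel 𝕜 N p q m = f := by
  obtain ⟨B, hB⟩ := exists_starKinetic_le_starEnergy 𝕜 N hp2 hp6 hq2 hq4 hm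
  have hge : ((-B : ℝ) : EReal) ≤ starLevel 𝕜 N p q m := le_iInf₂ fun u hu => by
    have h1 := hB u hu.1 hu.2
    have h2 := starKinetic_nonneg u
    exact EReal.coe_le_coe_iff.2 (by linarith)
  exact ⟨_, (EReal.coe_toReal hlt.ne ((EReal.bot_lt_coe _).trans_le hge).ne').symm⟩

theorem exists_seq_tendsto_starLevel (hf : starLevel 𝕜 N p q m = f) :
    ∃ w : ℕ → Fin N → ℝ → 𝕜, IsMinimizingSeq p q m w := by
  have hex : ∀ n : ℕ, ∃ u ∈ H1MassStar 𝕜 N m, starEnergy p q u < f + 1 / ((n : ℝ) + 1) := by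
    intro n
    have h1 : starLevel 𝕜 N p q m < ((f + 1 / ((n : ℝ) + 1) : ℝ) : EReal) := by
      rw [hf, EReal.coe_lt_coe_iff]
      have : 0 < 1 / ((n : ℝ) + 1) := by positivity
      linarith
    obtain ⟨u, hu⟩ := iInf_lt_iff.1 h1
    obtain ⟨hu1, hu2⟩ := iInf_lt_iff.1 hu
    exact ⟨u, hu1, EReal.coe_lt_coe_iff.1 hu2⟩
  choose w hw hwlt using hex
  refine ⟨w, hw, ?_⟩
  rw [hf]
  refine (continuous_coe_real_ereal.tendsto _).comp ?_
  have hup : Tendsto (fun n : ℕ => f + 1 / ((n : ℝ) + 1)) atTop (𝓝 f) := by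
    simpa using (tendsto_one_div_add_atTop_nhds_zero_nat (𝕜 := ℝ)).const_add f
  refine tendsto_of_tendsto_of_tendsto_of_le_of_le tendsto_const_nhds hup (fun n => ?_)
    fun n => (hwlt n).le
  have h2 : starLevel 𝕜 N p q m ≤ (starEnergy p q (w n) : EReal) := iInf₂_le (w n) (hw n)
  rw [hf] at h2
  exact EReal.coe_le_coe_iff.1 h2

theorem exists_isGroundState_tendsto_of_lt (hp2 : 2 < p) (hp6 : p < 6) (hq2 : 2 < q)
    (hq4 : q < 4) (hm : 0 < m) (hlt : starLevel 𝕜 N p q m < lineLevel 𝕜 p m)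
    {w : ℕ → Fin N → ℝ → 𝕜} (hw : IsMinimizingSeq p q m w) :
    ∃ u : Fin N → ℝ → 𝕜, IsGroundState p q m u ∧ ∃ k : ℕ → ℕ, StrictMono k ∧
      Tendsto (fun n => starH1NormSq (w (k n) - u)) atTop (𝓝 0) := by
  obtain ⟨f, hf⟩ := exists_starLevel_eq_coe hp2 hp6 hq2 hq4 hm (hlt.trans_le le_top)
  -- Any real number strictly between the levels serves as lower bound on the line, so finiteness of
  -- `lineLevel` need not be shown.
  obtain ⟨e, he1, he2⟩ := EReal.lt_iff_exists_real_btwn.1 hlt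
  rw [hf, EReal.coe_lt_coe_iff] at he1
  obtain ⟨hw1, hw2⟩ := hw
  rw [hf] at hw2
  obtain ⟨u, hu, huE, k, hk, hlim⟩ := exists_subseq_tendsto_of_lt (e := e) hp2 hp6 hq2 hq4 hm
    (fun v hv => EReal.coe_le_coe_iff.1 (he2.le.trans (iInf₂_le v hv))) he1
    (fun u hu => EReal.coe_le_coe_iff.1 (hf ▸ (iInf₂_le u hu : starLevel 𝕜 N p q m ≤ _))) hw1
    (EReal.tendsto_coe.1 hw2)
  exact ⟨u, ⟨hu, by rw [huE, hf]⟩, k, hk, hlim⟩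

end

end StarNLS

theorem proposition3p1 {𝕜 : Type*} [RCLike 𝕜] (N : ℕ) [NeZero N] (p q : ℝ)
    (hp2 : 2 < p) (hp6 : p < 6) (hq2 : 2 < q) (hq4 : q < 4) (m : ℝ) (hm : 0 < m) :
    StarNLS.starLevel 𝕜 N p q m ≤ StarNLS.lineLevel 𝕜 p m ∧
    (StarNLS.starLevel 𝕜 N p q m < StarNLS.lineLevel 𝕜 p m →
      (∃ u : Fin N → ℝ → 𝕜, StarNLS.IsGroundState p q m u) ∧
      ∀ w : ℕ → Fin N → ℝ → 𝕜, StarNLS.IsMinimizingSeq p q m w →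
        ∃ u : Fin N → ℝ → 𝕜, StarNLS.IsGroundState p q m u ∧
          ∃ k : ℕ → ℕ, StrictMono k ∧
            Tendsto (fun n => StarNLS.starH1NormSq (w (k n) - u)) atTop (𝓝 0)) := by
  refine ⟨StarNLS.starLevel_le_lineLevel hp2 hq2 hm, fun hlt => ⟨?_, fun w hw =>
    StarNLS.exists_isGroundState_tendsto_of_lt hp2 hp6 hq2 hq4 hm hlt hw⟩⟩
  obtain ⟨f, hf⟩ := StarNLS.exists_starLevel_eq_coe hp2 hp6 hq2 hq4 hm (hlt.trans_le le_top)
  obtain ⟨w, hw⟩ := StarNLS.exists_seq_tendsto_starLevel hf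
  obtain ⟨u, hu, -⟩ := StarNLS.exists_isGroundState_tendsto_of_lt hp2 hp6 hq2 hq4 hm hlt hw
  exact ⟨u, hu⟩
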